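/- An instance of Orthogonal Vectors (OV) with parameters $n$ and $d$ consists of $n$ vectors $v_1,\dots,v_n\in\{0,1\}^d$; it is a "yes" instance if there are $i\neq j$ with $\langle v_i,v_j\rangle=0$ (inner product over the integers), and a "no" instance otherwise. For $p\in(0,1)$ let $\mathrm{OV}(p)_{n,d}$ be the distribution on instances in which all $nd$ bits are independent, each equal to $1$ with probability $p$ and to $0$ otherwise. Formulas are Boolean formulas over the $nd$ input bits and the constants $0,1$, with NOT gates and with AND and OR gates of unbounded fan-in; the size of a formula is the number of its nodes (leaves and gates), and its depth is the largest number of gates on a path from the root to a leaf. **Theorem.** There are numbers $\varepsilon_p>0$ $(p\in(0,1))$ with $\varepsilon_p\to1$ as $p\to1$, and an absolute constant $D$, such that the following holds for every $p\in(0,1)$. There is a sequence $\delta_p(n)$ with $\delta_p(n)\to0$ as $n\to\infty$ such that for all integers $n\ge1$ and $d\ge0$ there is a formula $F$ over the bits of an OV instance, of depth at most $D$ (an $\mathsf{AC}^0$ formula) and of size at most $n^{2-\varepsilon_p}$, such that: 1. for every instance $x$, if $F(x)=1$ then $x$ is a "yes" instance (so $F$ always outputs $0$ if there is no orthogonal pair);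 2. with probability at least $1-\delta_p(n)$ over $x\sim\mathrm{OV}(p)_{n,d}$, $F$ answers $x$ correctly, that is, $F(x)=1$ if and only if $x$ is a "yes" instance. -/

import Mathlib

open Filter Topology MeasureTheory ProbabilityTheory

/-- Boolean formulas over the variables `ι`: trees whose leaves are variables or constants, with
NOT gates and with AND and OR gates of unbounded fan-in. -/
inductive BoolFormula (ι : Type) : Type
  | var (i : ι) : BoolFormula ι
  | const (b : Bool) : BoolFormula ι
  | not (f : BoolFormula ι) : BoolFormula ι
  | and (k : ℕ) (f : Fin k → BoolFormula ι) : BoolFormula ι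
  | or (k : ℕ) (f : Fin k → BoolFormula ι) : BoolFormula ι

namespace BoolFormula

/-- The value of a formula under an assignment of its variables. -/
def eval {ι : Type} (x : ι → Bool) : BoolFormula ι → Bool
  | var i => x i
  | const b => b
  | not f => !(f.eval x)
  | and _ f => decide (∀ i, (f i).eval x = true)
  | or _ f => decide (∃ i, (f i).eval x = true)

/-- The size of a formula: the number of all its nodes (leaves and gates, NOT gates included). -/
def size {ι : Type} : BoolFormula ι → ℕ
  | var _ => 1
  | const _ => 1
  | not f => f.size + 1
  | and _ f => (∑ i, (f i).size) + 1
  | or _ f => (∑ i, (f i).size) + 1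

/-- The depth of a formula: the largest number of gates (NOT gates included) on a path from the
root to a leaf. -/
def depth {ι : Type} : BoolFormula ι → ℕ
  | var _ => 0
  | const _ => 0
  | not f => f.depth + 1
  | and _ f => (Finset.univ.sup fun i => (f i).depth) + 1
  | or _ f => (Finset.univ.sup fun i => (f i).depth) + 1

end BoolFormula

/-- An instance of Orthogonal Vectors: `n` vectors in `{0,1}^d`. -/
abbrev OVInstance (n d : ℕ) : Type := Fin n → Fin d → Bool

/-- The inner product, over the integers, of two 0/1 vectors. -/
def boolInner {d : ℕ} (u v : Fin d → Bool) : ℕ := ∑ k, (u k).toNat * (v k).toNat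

/-- The instance is a "yes" instance: it has an orthogonal pair of vectors. -/
def OVInstance.HasOrthogonalPair {n d : ℕ} (x : OVInstance n d) : Prop :=
  ∃ i j : Fin n, i ≠ j ∧ boolInner (x i) (x j) = 0

/-- The output of a formula, whose variables are the `n * d` bits of an instance. -/
def BoolFormula.output {n d : ℕ} (F : BoolFormula (Fin n × Fin d)) (x : OVInstance n d) : Bool :=
  F.eval fun ik => x ik.1 ik.2

/-- The distribution `OV(p)_{n,d}`: all bits are independent, `1` with probability `p` and `0`
otherwise. -/
noncomputable def ovMeasure (p : unitInterval) (n d : ℕ) : Measure (OVInstance n d) :=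
  Measure.pi fun _ => Measure.pi fun _ => bernoulliMeasure true false p

/-!
Conditioned on being orthogonal, the vectors of a pair have density of ones `p / (1 + p) < p`. Cut
`√d * √d` coordinates into blocks of length `√d` and call a vector light if its density of ones on
every block is below a threshold between `p / (1 + p)` and `p`; as each block is short, lightness
has a formula of constant depth and size `2 ^ O(√d)`. The vectors of an orthogonal pair are
typically light, while any other vector is light with probability `exp (-Ω(d))` only. So when the
vectors are put into buckets of size `n ^ η`, the two vectors of a light orthogonal pair are
typically the only light ones in their buckets, and a pair of buckets is tested by comparing the
disjunctions of their light vectors, at a cost proportional to `n ^ η` instead of `n ^ (2 η)`.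
The error estimate needs the expected number of orthogonal pairs to be small; if it is large, a
subsample with few expected pairs is searched, which still contains one by the second moment method.

With `Λ = -log (1 - p ^ 2)`, there is typically no orthogonal pair once `Λ d ≥ 3 log n`, and for
smaller `d` exhaustive search over the sets of coordinates costs about `2 ^ d n ≤ n ^ (1 + 4 / Λ)`.
This gives savings tending to `1`, since `Λ → ∞` as `p → 1`.
-/

namespace BoolFormula

variable {ι κ : Type} {x : ι → Bool} {S : Finset κ} {f : κ → BoolFormula ι} {g h : BoolFormula ι}
  {c M D : ℕ}

/-- The conjunction of the formulas `f k` over `k ∈ S`, as a single gate. -/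
noncomputable def iAnd (S : Finset κ) (f : κ → BoolFormula ι) : BoolFormula ι :=
  and S.card fun r => f (S.equivFin.symm r)

/-- The disjunction of the formulas `f k` over `k ∈ S`, as a single gate. -/
noncomputable def iOr (S : Finset κ) (f : κ → BoolFormula ι) : BoolFormula ι :=
  or S.card fun r => f (S.equivFin.symm r)

/-- The conjunction of two formulas. -/
def and₂ (g h : BoolFormula ι) : BoolFormula ι := and 2 ![g, h]

/-- The disjunction of two formulas. -/
def or₂ (g h : BoolFormula ι) : BoolFormula ι := or 2 ![g, h]

@[simp] theorem eval_var (i : ι) : (var i).eval x = x i := rfl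

@[simp] theorem eval_not : g.not.eval x = true ↔ ¬ g.eval x = true := by
  simp [eval]

@[simp] theorem eval_iAnd : (iAnd S f).eval x = true ↔ ∀ k ∈ S, (f k).eval x = true := by
  simp only [iAnd, eval, decide_eq_true_eq]
  rw [S.equivFin.symm.forall_congr_left (p := fun r => (f (S.equivFin.symm r)).eval x = true)]
  simp

@[simp] theorem eval_iOr : (iOr S f).eval x = true ↔ ∃ k ∈ S, (f k).eval x = true := by
  simp only [iOr, eval, decide_eq_true_eq]
  rw [S.equivFin.symm.exists_congr_left (p := fun r => (f (S.equivFin.symm r)).eval x = true)]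
  simp

@[simp] theorem eval_and₂ : (and₂ g h).eval x = true ↔ g.eval x = true ∧ h.eval x = true := by
  simp [and₂, eval, Fin.forall_fin_two]

@[simp] theorem eval_or₂ : (or₂ g h).eval x = true ↔ g.eval x = true ∨ h.eval x = true := by
  simp [or₂, eval, Fin.exists_fin_two]

theorem size_iAnd_le (hc : S.card ≤ c) (hM : ∀ k ∈ S, (f k).size ≤ M) :
    (iAnd S f).size ≤ c * M + 1 := by
  simp only [iAnd, size]
  gcongr
  calc ∑ r, (f (S.equivFin.symm r)).size ≤ ∑ _ : Fin S.card, M := by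
        gcongr with r
        exact hM _ (S.equivFin.symm r).2
    _ = S.card * M := by simp
    _ ≤ c * M := by gcongr

theorem size_iOr_le (hc : S.card ≤ c) (hM : ∀ k ∈ S, (f k).size ≤ M) :
    (iOr S f).size ≤ c * M + 1 :=
  size_iAnd_le hc hM

theorem size_and₂ : (and₂ g h).size = g.size + h.size + 1 := by
  simp [and₂, size]

theorem size_or₂ : (or₂ g h).size = g.size + h.size + 1 := by
  simp [or₂, size]

theorem depth_not_le (hg : g.depth ≤ D) : g.not.depth ≤ D + 1 := by
  simpa [depth] using hg

theorem depth_iAnd_le (hD : ∀ k ∈ S, (f k).depth ≤ D) : (iAnd S f).depth ≤ D + 1 := by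
  simp only [iAnd, depth]
  gcongr
  exact Finset.sup_le fun r _ => hD _ (S.equivFin.symm r).2

theorem depth_iOr_le (hD : ∀ k ∈ S, (f k).depth ≤ D) : (iOr S f).depth ≤ D + 1 :=
  depth_iAnd_le hD

theorem depth_and₂_le (hg : g.depth ≤ D) (hh : h.depth ≤ D) : (and₂ g h).depth ≤ D + 1 := by
  simp [and₂, depth, Finset.sup_le_iff, Fin.forall_fin_two, hg, hh]

theorem depth_or₂_le (hg : g.depth ≤ D) (hh : h.depth ≤ D) : (or₂ g h).depth ≤ D + 1 :=
  depth_and₂_le hg hh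

end BoolFormula

theorem disjoint_boolVec_iff {κ : Type*} {u v : κ → Bool} :
    Disjoint u v ↔ ∀ k, ¬ (u k = true ∧ v k = true) := by
  rw [Pi.disjoint_iff]
  refine forall_congr' fun k => ?_
  cases u k <;> cases v k <;> simp [disjoint_iff]

theorem boolInner_eq_zero_iff {d : ℕ} {u v : Fin d → Bool} :
    boolInner u v = 0 ↔ Disjoint u v := by
  simp only [boolInner, disjoint_boolVec_iff, Finset.sum_eq_zero_iff, Finset.mem_univ,
    true_imp_iff]
  refine forall_congr' fun k => ?_
  cases u k <;> cases v k <;> simp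

theorem OVInstance.hasOrthogonalPair_iff {n d : ℕ} {x : OVInstance n d} :
    x.HasOrthogonalPair ↔ ∃ i j, i ≠ j ∧ Disjoint (x i) (x j) := by
  simp only [OVInstance.HasOrthogonalPair, boolInner_eq_zero_iff]

theorem card_offDiag_le {κ : Type*} {S : Finset κ} {c : ℕ} (h : S.card ≤ c) :
    S.offDiag.card ≤ c ^ 2 := by
  classical
  rw [Finset.offDiag_card, sq]
  exact (Nat.sub_le _ _).trans (Nat.mul_le_mul h h)

namespace BoolFormula

variable {n d b w M : ℕ} {x : OVInstance n d} {L : Fin n → BoolFormula (Fin n × Fin d)}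
  {B B' V : Finset (Fin n)} {f : Fin n → Fin b}

/-- The formula saying that the vector `i` vanishes on the set `S` of coordinates. -/
noncomputable def zeroOn (i : Fin n) (S : Finset (Fin d)) : BoolFormula (Fin n × Fin d) :=
  iAnd S fun k => not (var (i, k))

/-- The exhaustive formula: for some set `S` of coordinates, some vector vanishes on `S` and some
vector vanishes off `S`. -/
noncomputable def exhaustive (n d : ℕ) : BoolFormula (Fin n × Fin d) :=
  iOr (Finset.univ : Finset (Finset (Fin d))) fun S =>
    and₂ (iOr Finset.univ fun i => zeroOn i S) (iOr Finset.univ fun j => zeroOn j Sᶜ)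

theorem output_exhaustive_iff :
    (exhaustive n d).output x = true ↔ ∃ i j, Disjoint (x i) (x j) := by
  simp only [output, exhaustive, zeroOn, eval_iOr, eval_and₂, eval_iAnd, eval_not, eval_var,
    Finset.mem_univ, true_and, Finset.mem_compl, disjoint_boolVec_iff]
  constructor
  · rintro ⟨S, ⟨i, hi⟩, j, hj⟩
    refine ⟨i, j, fun k ⟨hik, hjk⟩ => ?_⟩
    by_cases hk : k ∈ S
    · exact hi k hk hik
    · exact hj k hk hjk
  · rintro ⟨i, j, hij⟩
    refine ⟨Finset.univ.filter fun k => ¬ x i k = true, ⟨i, by simp⟩, j, fun k hk hjk =>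
      hij k ⟨?_, hjk⟩⟩
    simpa using hk

theorem output_exhaustive (hn : 2 ≤ n) :
    (exhaustive n d).output x = true ↔ x.HasOrthogonalPair := by
  rw [output_exhaustive_iff, OVInstance.hasOrthogonalPair_iff]
  constructor
  · rintro ⟨i, j, hij⟩
    obtain rfl | hne := eq_or_ne i j
    · have : Nontrivial (Fin n) := Fin.nontrivial_iff_two_le.2 hn
      obtain ⟨l, hl⟩ := exists_ne i
      -- A vector orthogonal to itself is zero, hence orthogonal to every other vector.
      exact ⟨i, l, hl.symm, (disjoint_self.1 hij).symm ▸ disjoint_bot_left⟩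
    · exact ⟨i, j, hne, hij⟩
  · rintro ⟨i, j, -, hij⟩
    exact ⟨i, j, hij⟩

theorem size_zeroOn_le (i : Fin n) (S : Finset (Fin d)) : (zeroOn i S).size ≤ d * 2 + 1 :=
  size_iAnd_le (S.card_le_univ.trans_eq (Fintype.card_fin d)) fun k _ => by simp [size]

theorem size_exhaustive_le :
    (exhaustive n d).size ≤ 2 ^ d * (2 * (n * (d * 2 + 1) + 1) + 1) + 1 := by
  refine size_iOr_le (by simp) fun S _ => ?_
  rw [size_and₂, two_mul (n * _ + 1)]
  gcongr <;> exact size_iOr_le (by simp) fun i _ => size_zeroOn_le _ _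

theorem depth_exhaustive_le : (exhaustive n d).depth ≤ 5 :=
  have depth_zeroOn_le (i : Fin n) (S : Finset (Fin d)) : (zeroOn i S).depth ≤ 2 :=
    depth_iAnd_le fun _ _ => depth_not_le le_rfl
  depth_iOr_le fun _ _ => depth_and₂_le (depth_iOr_le fun _ _ => depth_zeroOn_le _ _)
    (depth_iOr_le fun _ _ => depth_zeroOn_le _ _)

/-- The formula saying that the vectors `i` and `j` are orthogonal. -/
noncomputable def pairTest (i j : Fin n) : BoolFormula (Fin n × Fin d) :=
  iAnd Finset.univ fun k => not (and₂ (var (i, k)) (var (j, k)))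

/-- The `k`-th bit of the disjunction of the vectors in `B` that pass the filter `L`. -/
noncomputable def filteredBit (L : Fin n → BoolFormula (Fin n × Fin d)) (B : Finset (Fin n))
    (k : Fin d) : BoolFormula (Fin n × Fin d) :=
  iOr B fun i => and₂ (L i) (var (i, k))

/-- The formula saying that both `B` and `B'` have vectors passing the filter `L` and that all
such vectors of `B` are orthogonal to all such vectors of `B'`. -/
noncomputable def crossTest (L : Fin n → BoolFormula (Fin n × Fin d)) (B B' : Finset (Fin n)) :
    BoolFormula (Fin n × Fin d) :=
  and₂ (and₂ (iOr B L) (iOr B' L))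
    (iAnd Finset.univ fun k => not (and₂ (filteredBit L B k) (filteredBit L B' k)))

/-- The members of `V` that the bucketing function `f` sends to the bucket `c`. -/
def bucket (V : Finset (Fin n)) (f : Fin n → Fin b) (c : Fin b) : Finset (Fin n) :=
  V.filter fun i => f i = c

/-- The search for an orthogonal pair among the vectors in `V`: a cross test, with the filter `L`,
for every pair of distinct buckets, and a test of every pair of vectors in a common bucket. -/
noncomputable def bucketFormula (L : Fin n → BoolFormula (Fin n × Fin d)) (V : Finset (Fin n))
    (f : Fin n → Fin b) : BoolFormula (Fin n × Fin d) :=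
  or₂
    (iOr (Finset.univ : Finset (Fin b)).offDiag fun P =>
      crossTest L (bucket V f P.1) (bucket V f P.2))
    (iOr Finset.univ fun c => iOr (bucket V f c).offDiag fun P => pairTest P.1 P.2)

theorem mem_bucket {i : Fin n} {c : Fin b} : i ∈ bucket V f c ↔ i ∈ V ∧ f i = c :=
  Finset.mem_filter

theorem output_pairTest {i j : Fin n} :
    (pairTest i j).output x = true ↔ Disjoint (x i) (x j) := by
  simp [output, pairTest, disjoint_boolVec_iff]

theorem output_crossTest :
    (crossTest L B B').output x = true ↔
      (∃ i ∈ B, (L i).output x = true) ∧ (∃ j ∈ B', (L j).output x = true) ∧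
        ∀ i ∈ B, ∀ j ∈ B', (L i).output x = true → (L j).output x = true →
          Disjoint (x i) (x j) := by
  simp only [output, crossTest, filteredBit, eval_iOr, eval_and₂, eval_iAnd, eval_not, eval_var,
    Finset.mem_univ, true_imp_iff, and_assoc, disjoint_boolVec_iff]
  grind

theorem output_bucketFormula_iff :
    (bucketFormula L V f).output x = true ↔
      (∃ c c', c ≠ c' ∧ (crossTest L (bucket V f c) (bucket V f c')).output x = true) ∨
      ∃ c, ∃ i ∈ bucket V f c, ∃ j ∈ bucket V f c, i ≠ j ∧ Disjoint (x i) (x j) := by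
  simp only [← output_pairTest (x := x)]
  simp only [output, bucketFormula, eval_or₂, eval_iOr, Finset.mem_univ, true_and,
    Finset.mem_offDiag, Prod.exists]
  grind

theorem hasOrthogonalPair_of_output_bucketFormula (h : (bucketFormula L V f).output x = true) :
    x.HasOrthogonalPair := by
  rw [OVInstance.hasOrthogonalPair_iff]
  rcases output_bucketFormula_iff.1 h with ⟨c, c', hc, hcross⟩ | ⟨c, i, -, j, -, hij⟩
  · obtain ⟨⟨i, hi, hLi⟩, ⟨j, hj, hLj⟩, hdisj⟩ := output_crossTest.1 hcross
    refine ⟨i, j, ?_, hdisj i hi j hj hLi hLj⟩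
    rintro rfl
    exact hc ((mem_bucket.1 hi).2.symm.trans (mem_bucket.1 hj).2)
  · exact ⟨i, j, hij⟩

theorem output_bucketFormula_of_isolated {i j : Fin n} (hij : i ≠ j)
    (hdisj : Disjoint (x i) (x j)) (hi : i ∈ V) (hj : j ∈ V) (hLi : (L i).output x = true)
    (hLj : (L j).output x = true)
    (hiso : ∀ l ∈ V, l ≠ i → l ≠ j → f l = f i ∨ f l = f j → ¬ (L l).output x = true) :
    (bucketFormula L V f).output x = true := by
  rw [output_bucketFormula_iff]
  by_cases hc : f i = f j
  · exact .inr ⟨f i, i, mem_bucket.2 ⟨hi, rfl⟩, j, mem_bucket.2 ⟨hj, hc.symm⟩, hij, hdisj⟩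
  · refine .inl ⟨f i, f j, hc, output_crossTest.2 ⟨⟨i, mem_bucket.2 ⟨hi, rfl⟩, hLi⟩,
      ⟨j, mem_bucket.2 ⟨hj, rfl⟩, hLj⟩, fun i' hi' j' hj' hLi' hLj' => ?_⟩⟩
    rw [mem_bucket] at hi' hj'
    obtain rfl : i' = i := by grind
    obtain rfl : j' = j := by grind
    exact hdisj

theorem size_pairTest_le (i j : Fin n) :
    (pairTest i j : BoolFormula (Fin n × Fin d)).size ≤ d * 4 + 1 :=
  size_iAnd_le (by simp) fun k _ => by simp [size, size_and₂]

theorem size_filteredBit_le (hM : ∀ i, (L i).size ≤ M) (hB : B.card ≤ w) (k : Fin d) :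
    (filteredBit L B k).size ≤ w * (M + 2) + 1 :=
  size_iOr_le hB fun i _ => by
    have := hM i
    simp only [size_and₂, size]
    omega

theorem size_crossTest_le (hM : ∀ i, (L i).size ≤ M) (hB : B.card ≤ w) (hB' : B'.card ≤ w) :
    (crossTest L B B').size ≤ 2 * (w * M + 1) + d * (2 * (w * (M + 2) + 1) + 2) + 3 := by
  have hbits : (iAnd Finset.univ fun k => not (and₂ (filteredBit L B k)
      (filteredBit L B' k))).size ≤ d * (2 * (w * (M + 2) + 1) + 2) + 1 :=
    size_iAnd_le (by simp) fun k _ => by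
      have h₁ := size_filteredBit_le hM hB k
      have h₂ := size_filteredBit_le hM hB' k
      simp only [size, size_and₂]
      omega
  have hacc : (iOr B L).size ≤ w * M + 1 := size_iOr_le hB fun i _ => hM i
  have hacc' : (iOr B' L).size ≤ w * M + 1 := size_iOr_le hB' fun i _ => hM i
  simp only [crossTest, size_and₂]
  omega

theorem size_bucketFormula_le (hM : ∀ i, (L i).size ≤ M) (hf : ∀ c, (bucket V f c).card ≤ w)
    (hb : 1 ≤ b) (hw : 1 ≤ w) :
    (bucketFormula L V f).size ≤ 8 * (M + 1) * (d + 1) * (b ^ 2 * w + b * w ^ 2) := by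
  have hcross := size_iOr_le (S := (Finset.univ : Finset (Fin b)).offDiag)
    (f := fun P => crossTest L (bucket V f P.1) (bucket V f P.2))
    (card_offDiag_le (Finset.card_fin b).le) fun P _ => size_crossTest_le hM (hf P.1) (hf P.2)
  have hinner := size_iOr_le (S := (Finset.univ : Finset (Fin b)))
    (f := fun c => iOr (bucket V f c).offDiag fun P =>
      (pairTest P.1 P.2 : BoolFormula (Fin n × Fin d))) (Finset.card_fin b).le
    fun c _ => size_iOr_le (card_offDiag_le (hf c)) fun P _ => size_pairTest_le P.1 P.2
  have hX : b ^ 2 ≤ b ^ 2 * w := Nat.le_mul_of_pos_right _ hw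
  have hY : b ≤ b * w ^ 2 := Nat.le_mul_of_pos_right _ (by positivity)
  rw [bucketFormula, size_or₂]
  calc _ ≤ b ^ 2 * (2 * (w * M + 1) + d * (2 * (w * (M + 2) + 1) + 2) + 3) + 1 +
        (b * (w ^ 2 * (d * 4 + 1) + 1) + 1) + 1 := by gcongr
    _ = b ^ 2 * w * (2 * M + 2 * d * M + 4 * d) + b ^ 2 * (4 * d + 5) +
        (b * w ^ 2 * (4 * d + 1) + b + 3) := by ring
    _ ≤ b ^ 2 * w * (2 * M + 2 * d * M + 4 * d) + b ^ 2 * w * (4 * d + 5) +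
        (b * w ^ 2 * (4 * d + 1) + b * w ^ 2 + 3 * (b * w ^ 2)) := by
      gcongr
      omega
    _ = b ^ 2 * w * (2 * M + 2 * d * M + 8 * d + 5) + b * w ^ 2 * (4 * d + 5) := by ring
    _ ≤ b ^ 2 * w * (8 * (M + 1) * (d + 1)) + b * w ^ 2 * (8 * (M + 1) * (d + 1)) := by
      gcongr <;> nlinarith [Nat.zero_le (d * M)]
    _ = 8 * (M + 1) * (d + 1) * (b ^ 2 * w + b * w ^ 2) := by ring

theorem depth_bucketFormula_le (hL : ∀ i, (L i).depth ≤ 3) : (bucketFormula L V f).depth ≤ 12 := by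
  have hbit (B k) : (filteredBit L B k).depth ≤ 5 :=
    depth_iOr_le fun i _ => depth_and₂_le (hL i) (by simp [depth])
  have hcross (B B') : (crossTest L B B').depth ≤ 9 :=
    depth_and₂_le
      ((depth_and₂_le (depth_iOr_le fun i _ => hL i) (depth_iOr_le fun i _ => hL i)).trans
        (by norm_num))
      (depth_iAnd_le fun k _ => depth_not_le (depth_and₂_le (hbit B k) (hbit B' k)))
  have hpair (i j : Fin n) : (pairTest i j : BoolFormula (Fin n × Fin d)).depth ≤ 3 :=
    depth_iAnd_le fun k _ => depth_not_le (depth_and₂_le le_rfl le_rfl)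
  exact depth_or₂_le ((depth_iOr_le fun P _ => hcross _ _).trans (by norm_num))
    ((depth_iOr_le fun c _ => depth_iOr_le fun P _ => hpair _ _).trans (by norm_num))

/-- The filter given by a family `𝒯` of sets of coordinates: the vector `i` has a zero in each of
the sets. -/
noncomputable def zeroInEach (𝒯 : Finset (Finset (Fin d))) (i : Fin n) :
    BoolFormula (Fin n × Fin d) :=
  iAnd 𝒯 fun T => iOr T fun k => not (var (i, k))

theorem output_zeroInEach {𝒯 : Finset (Finset (Fin d))} {i : Fin n} :
    (zeroInEach 𝒯 i).output x = true ↔ ∀ T ∈ 𝒯, ∃ k ∈ T, ¬ x i k = true := by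
  simp only [output, zeroInEach, eval_iAnd, eval_iOr, eval_not, eval_var]

theorem size_zeroInEach_le {𝒯 : Finset (Finset (Fin d))} {s c : ℕ} (hc : 𝒯.card ≤ c)
    (hs : ∀ T ∈ 𝒯, T.card ≤ s) (i : Fin n) : (zeroInEach 𝒯 i).size ≤ c * (s * 2 + 1) + 1 :=
  size_iAnd_le hc fun T hT => size_iOr_le (hs T hT) fun k _ => by simp [size]

theorem depth_zeroInEach_le (𝒯 : Finset (Finset (Fin d))) (i : Fin n) :
    (zeroInEach 𝒯 i).depth ≤ 3 :=
  depth_iAnd_le fun _ _ => depth_iOr_le fun _ _ => depth_not_le le_rfl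

end BoolFormula

theorem exists_disjoint_blocks {κ : Type*} [Fintype κ] {r s : ℕ} (h : r * s ≤ Fintype.card κ) :
    ∃ B : Fin r → Finset κ, Pairwise (Function.onFun Disjoint B) ∧ ∀ c, (B c).card = s := by
  obtain ⟨e⟩ : Nonempty (Fin r × Fin s ↪ κ) :=
    Function.Embedding.nonempty_of_card_le (by simpa using h)
  refine ⟨fun c => ({c} ×ˢ Finset.univ).map e, fun c c' hc => ?_, fun c => by simp⟩
  exact (Finset.disjoint_map e).2 (Finset.disjoint_product.2 (.inl (by simpa using hc)))

theorem exists_fibres_card_le {ι : Type*} {V : Finset ι} {b w : ℕ} (hb : 1 ≤ b)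
    (h : V.card ≤ b * w) : ∃ f : ι → Fin b, ∀ c, (V.filter fun i => f i = c).card ≤ w := by
  classical
  obtain ⟨e⟩ : Nonempty (V ↪ Fin b × Fin w) :=
    Function.Embedding.nonempty_of_card_le (by simpa using h)
  refine ⟨fun i => if hi : i ∈ V then (e ⟨i, hi⟩).1 else ⟨0, hb⟩, fun c => ?_⟩
  calc _ ≤ (Finset.univ.filter fun i : V => (e i).1 = c).card := by
        refine Finset.card_le_card_of_surjOn Subtype.val fun i hi => ?_
        obtain ⟨hiV, hic⟩ := Finset.mem_filter.1 (Finset.mem_coe.1 hi)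
        exact ⟨⟨i, hiV⟩, by simpa [hiV] using hic, rfl⟩
    _ ≤ (Finset.univ : Finset (Fin w)).card := by
        refine Finset.card_le_card_of_injOn (fun i => (e i).2) (fun i _ => Finset.mem_univ _) ?_
        intro i hi j hj hij
        refine e.injective (Prod.ext ?_ hij)
        exact (Finset.mem_filter.1 hi).2.trans (Finset.mem_filter.1 hj).2.symm
    _ = w := Finset.card_fin w

section Light

variable {ι κ : Type*} {B : ι → Finset κ} {θ : ℝ} {u : κ → Bool}

/-- The number of ones of the vector `u` on the set `A` of coordinates. -/
def ones (u : κ → Bool) (A : Finset κ) : ℕ := (A.filter fun k => u k = true).card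

/-- A vector is light if on each of the blocks `B c` its density of ones is at most `θ`. -/
def IsLight (B : ι → Finset κ) (θ : ℝ) (u : κ → Bool) : Prop :=
  ∀ c, (ones u (B c) : ℝ) ≤ θ * (B c).card

/-- The sets of coordinates witnessing that a vector is not light: those that fill more than a
fraction `θ` of a block containing them. -/
noncomputable def heavySets [Fintype ι] [DecidableEq κ] (B : ι → Finset κ) (θ : ℝ) :
    Finset (Finset κ) :=
  Finset.univ.biUnion fun c => (B c).powerset.filter fun T => θ * (B c).card < T.card

variable [Fintype ι] [DecidableEq κ]

theorem mem_heavySets {T : Finset κ} :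
    T ∈ heavySets B θ ↔ ∃ c, T ⊆ B c ∧ θ * (B c).card < T.card := by
  simp [heavySets]

theorem forall_heavySets_iff_isLight :
    (∀ T ∈ heavySets B θ, ∃ k ∈ T, ¬ u k = true) ↔ IsLight B θ u := by
  constructor
  · intro h c
    by_contra! hc
    obtain ⟨k, hk, hu⟩ := h _ (mem_heavySets.2 ⟨c, Finset.filter_subset _ _, hc⟩)
    exact hu (Finset.mem_filter.1 hk).2
  · intro h T hT
    obtain ⟨c, hTc, hcard⟩ := mem_heavySets.1 hT
    by_contra! hu
    have hle : T.card ≤ ones u (B c) :=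
      Finset.card_le_card fun k hk => Finset.mem_filter.2 ⟨hTc hk, hu k hk⟩
    exact absurd (h c) (not_le.2 (hcard.trans_le (Nat.cast_le.2 hle)))

theorem card_heavySets_le {s : ℕ} (hB : ∀ c, (B c).card ≤ s) :
    (heavySets B θ).card ≤ Fintype.card ι * 2 ^ s := by
  refine Finset.card_biUnion_le_card_mul _ _ _ fun c _ => (Finset.card_filter_le _ _).trans ?_
  rw [Finset.card_powerset]
  exact Nat.pow_le_pow_right two_pos (hB c)

theorem card_le_of_mem_heavySets {s : ℕ} (hB : ∀ c, (B c).card ≤ s) {T : Finset κ}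
    (hT : T ∈ heavySets B θ) : T.card ≤ s := by
  obtain ⟨c, hTc, -⟩ := mem_heavySets.1 hT
  exact (Finset.card_le_card hTc).trans (hB c)

end Light

section Search

variable {n d b s w : ℕ} {B : Fin s → Finset (Fin d)} {θ : ℝ} {V : Finset (Fin n)}
  {f : Fin n → Fin b} {x : OVInstance n d}

/-- The bucketed search among the vectors in `V`, filtered by lightness. -/
noncomputable def searchFormula (B : Fin s → Finset (Fin d)) (θ : ℝ) (V : Finset (Fin n))
    (f : Fin n → Fin b) : BoolFormula (Fin n × Fin d) :=
  .bucketFormula (.zeroInEach (heavySets B θ)) V f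

theorem hasOrthogonalPair_of_output_searchFormula (h : (searchFormula B θ V f).output x = true) :
    x.HasOrthogonalPair :=
  BoolFormula.hasOrthogonalPair_of_output_bucketFormula h

theorem output_searchFormula_of_isolated {i j : Fin n} (hij : i ≠ j)
    (hdisj : Disjoint (x i) (x j)) (hi : i ∈ V) (hj : j ∈ V) (hLi : IsLight B θ (x i))
    (hLj : IsLight B θ (x j))
    (hiso : ∀ l ∈ V, l ≠ i → l ≠ j → f l = f i ∨ f l = f j → ¬ IsLight B θ (x l)) :
    (searchFormula B θ V f).output x = true := by
  simp only [← forall_heavySets_iff_isLight, ← BoolFormula.output_zeroInEach (x := x)]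
    at hLi hLj hiso
  exact BoolFormula.output_bucketFormula_of_isolated hij hdisj hi hj hLi hLj hiso

theorem depth_searchFormula_le : (searchFormula B θ V f).depth ≤ 12 :=
  BoolFormula.depth_bucketFormula_le fun i => BoolFormula.depth_zeroInEach_le _ i

theorem size_searchFormula_le (hB : ∀ c, (B c).card ≤ s) (hs : s * s ≤ d)
    (hf : ∀ c, (BoolFormula.bucket V f c).card ≤ w) (hb : 1 ≤ b) (hw : 1 ≤ w) :
    (searchFormula B θ V f).size ≤ 24 * (d + 1) ^ 2 * 2 ^ s * (b ^ 2 * w + b * w ^ 2) := by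
  have hL : ∀ i : Fin n, (BoolFormula.zeroInEach (heavySets B θ) i).size ≤
      s * 2 ^ s * (s * 2 + 1) + 1 :=
    BoolFormula.size_zeroInEach_le (by simpa using card_heavySets_le hB)
      fun T hT => card_le_of_mem_heavySets hB hT
  have hfilter : s * 2 ^ s * (s * 2 + 1) + 1 + 1 ≤ 3 * (d + 1) * 2 ^ s :=
    calc s * 2 ^ s * (s * 2 + 1) + 1 + 1 ≤ s * 2 ^ s * (s * 2 + 1) + 2 * 2 ^ s := by
          have := Nat.one_le_two_pow (n := s)
          omega
      _ = (2 * (s * s) + s + 2) * 2 ^ s := by ring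
      _ ≤ 3 * (d + 1) * 2 ^ s := by
          have := Nat.le_mul_self s
          gcongr
          omega
  calc _ ≤ 8 * (s * 2 ^ s * (s * 2 + 1) + 1 + 1) * (d + 1) * (b ^ 2 * w + b * w ^ 2) :=
        BoolFormula.size_bucketFormula_le hL hf hb hw
    _ ≤ 8 * (3 * (d + 1) * 2 ^ s) * (d + 1) * (b ^ 2 * w + b * w ^ 2) := by gcongr
    _ = 24 * (d + 1) ^ 2 * 2 ^ s * (b ^ 2 * w + b * w ^ 2) := by ring

end Search

section Independence

theorem measureReal_pi_forall_mem {ι : Type*} [Fintype ι] {E : ι → Type*}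
    [∀ i, MeasurableSpace (E i)] (ν : ∀ i, Measure (E i)) [∀ i, IsProbabilityMeasure (ν i)]
    (J : Finset ι) (S : ∀ i, Set (E i)) :
    (Measure.pi ν).real {x | ∀ j ∈ J, x j ∈ S j} = ∏ j ∈ J, (ν j).real (S j) := by
  classical
  have hpi : {x | ∀ j ∈ J, x j ∈ S j} = Set.univ.pi fun i => if i ∈ J then S i else Set.univ := by
    ext x
    simp only [Set.mem_ofPred_eq, Set.mem_univ_pi]
    refine forall_congr' fun i => ?_
    split_ifs with hi <;> simp [hi]
  rw [hpi, measureReal_def, Measure.pi_pi, ENNReal.toReal_prod, ← Finset.prod_ite_mem_eq J]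
  refine Finset.prod_congr rfl fun i _ => ?_
  split_ifs <;> simp [measureReal_def]

theorem setIntegral_eq_sum {E : Type*} [Fintype E] [MeasurableSpace E]
    [DiscreteMeasurableSpace E] {ν : Measure E} [IsFiniteMeasure ν] (S : Set E) (g : E → ℝ) :
    ∫ u in S, g u ∂ν = ∑ u, ν.real {u} * S.indicator g u := by
  rw [← integral_indicator .of_discrete, integral_fintype .of_finite]
  rfl

variable {ι E : Type*} [Fintype ι] [MeasurableSpace E] {ν : Measure E} [IsProbabilityMeasure ν]

theorem iIndepFun_eval_pi : iIndepFun (fun i (x : ι → E) => x i) (Measure.pi fun _ => ν) :=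
  iIndepFun_pi (X := fun _ => id) fun _ => aemeasurable_id

theorem measureReal_eval_fibre [Finite E] [DiscreteMeasurableSpace E] {i : ι} {J : Finset ι}
    (hi : i ∉ J) (S : Set E) (T : ι → E → Set E) :
    (Measure.pi fun _ : ι => ν).real {x | x i ∈ S ∧ ∀ j ∈ J, x j ∈ T j (x i)} =
      ∫ u in S, ∏ j ∈ J, ν.real (T j u) ∂ν := by
  classical
  have := Fintype.ofFinite E
  set P := Measure.pi fun _ : ι => ν
  set A := {x : ι → E | x i ∈ S ∧ ∀ j ∈ J, x j ∈ T j (x i)} with hA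
  have hfibre (u : E) : P.real ((fun x => x i) ⁻¹' {u} ∩ A) =
      ν.real {u} * S.indicator (fun u => ∏ j ∈ J, ν.real (T j u)) u := by
    by_cases hu : u ∈ S
    · have hne (j) (hj : j ∈ J) : j ≠ i := fun h => hi (h ▸ hj)
      have heq : (fun x => x i) ⁻¹' {u} ∩ A =
          {x | ∀ j ∈ insert i J, x j ∈ if j = i then {u} else T j u} := by
        ext x
        simp +contextual only [hA, Set.mem_inter_iff, Set.mem_preimage, Set.mem_singleton_iff,
          Set.mem_ofPred_eq, Finset.forall_mem_insert, if_true, hne, if_false, hu, true_and,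
          and_congr_right_iff, implies_true]
      rw [heq, measureReal_pi_forall_mem, Finset.prod_insert hi, if_pos rfl,
        Set.indicator_of_mem hu]
      congr 1
      exact Finset.prod_congr rfl fun j hj => by rw [if_neg (hne j hj)]
    · have hempty : (fun x => x i) ⁻¹' {u} ∩ A = ∅ := by
        ext x
        simp only [hA, Set.mem_inter_iff, Set.mem_preimage, Set.mem_singleton_iff,
          Set.mem_ofPred_eq, Set.mem_empty_iff_false, iff_false, not_and]
        rintro rfl h
        exact absurd h hu
      rw [hempty, measureReal_empty, Set.indicator_of_notMem hu, mul_zero]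
  have hmeas (u : E) : MeasurableSet ((fun x : ι → E => x i) ⁻¹' {u}) :=
    measurable_pi_apply i .of_discrete
  calc P.real A = ∑ u, (P.restrict A).real ((fun x => x i) ⁻¹' {u}) := by
        rw [sum_measureReal_preimage_singleton _ fun u _ => hmeas u]
        simp
    _ = ∑ u, ν.real {u} * S.indicator (fun u => ∏ j ∈ J, ν.real (T j u)) u := by
        simp only [measureReal_restrict_apply (hmeas _), hfibre]
    _ = _ := (setIntegral_eq_sum S _).symm

end Independence

section RandomVectors

variable {κ : Type*} [Fintype κ] {p : unitInterval} {A : Finset κ} {t : ℝ}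

/-- The distribution of a random vector of independent bits, each `1` with probability `p`. -/
noncomputable def bitMeasure (p : unitInterval) (κ : Type*) [Fintype κ] : Measure (κ → Bool) :=
  Measure.pi fun _ => bernoulliMeasure true false p

instance : IsProbabilityMeasure (bitMeasure p κ) := by
  unfold bitMeasure
  infer_instance

/-- The density of ones of a random vector conditioned on being orthogonal to an independent
copy. -/
noncomputable def orthParam (p : unitInterval) : unitInterval :=
  ⟨p / (1 + p), unitInterval.div_mem p.2.1 (by linarith [p.2.1]) (by linarith)⟩

theorem coe_orthParam : (orthParam p : ℝ) = p / (1 + p) := rfl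

theorem measureReal_bitMeasure_pi (S : κ → Set Bool) :
    (bitMeasure p κ).real {u | ∀ k, u k ∈ S k} =
      ∏ k, (bernoulliMeasure true false p).real (S k) := by
  simpa [bitMeasure] using
    measureReal_pi_forall_mem (fun _ => bernoulliMeasure true false p) Finset.univ S

theorem measureReal_bitMeasure_singleton (u : κ → Bool) :
    (bitMeasure p κ).real {u} = ∏ k, if u k then (p : ℝ) else 1 - p := by
  have : {u} = {v : κ → Bool | ∀ k, v k ∈ ({u k} : Set Bool)} := by
    ext v
    simp [funext_iff]
  rw [this, measureReal_bitMeasure_pi]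
  refine Finset.prod_congr rfl fun k _ => ?_
  rw [bernoulliMeasure_real_apply p (by simp)]
  cases u k <;> simp

theorem pow_ones_univ (a : ℝ) (u : κ → Bool) :
    a ^ ones u Finset.univ = ∏ k, if u k then a else 1 := by
  rw [Finset.prod_ite, Finset.prod_const, Finset.prod_const_one, mul_one, ones]

theorem measureReal_disjoint (u : κ → Bool) :
    (bitMeasure p κ).real {v | Disjoint u v} = (1 - p : ℝ) ^ ones u Finset.univ := by
  have : {v | Disjoint u v} = {v : κ → Bool | ∀ k, v k ∈ {b | ¬ (u k = true ∧ b = true)}} := by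
    ext v
    exact disjoint_boolVec_iff
  rw [this, measureReal_bitMeasure_pi, pow_ones_univ]
  refine Finset.prod_congr rfl fun k _ => ?_
  rw [bernoulliMeasure_real_apply p (by simp)]
  cases u k <;> simp

-- A pair of orthogonal bits is `(0,0)`, `(1,0)` or `(0,1)`, with probabilities proportional to
-- `1 - p`, `p` and `p`; this is where `p / (1 + p)` comes from.
theorem setIntegral_pow_ones (S : Set (κ → Bool)) :
    ∫ u in S, (1 - p : ℝ) ^ ones u Finset.univ ∂bitMeasure p κ =
      (1 - (p : ℝ) ^ 2) ^ Fintype.card κ * (bitMeasure (orthParam p) κ).real S := by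
  have hp : (1 + p : ℝ) ≠ 0 := by linarith [p.2.1]
  have hpoint (u : κ → Bool) : (bitMeasure p κ).real {u} * (1 - p : ℝ) ^ ones u Finset.univ =
      (1 - (p : ℝ) ^ 2) ^ Fintype.card κ * (bitMeasure (orthParam p) κ).real {u} := by
    rw [measureReal_bitMeasure_singleton, measureReal_bitMeasure_singleton, pow_ones_univ,
      ← Finset.card_univ, ← Finset.prod_const, ← Finset.prod_mul_distrib,
      ← Finset.prod_mul_distrib]
    refine Finset.prod_congr rfl fun k _ => ?_
    rw [coe_orthParam]
    cases u k <;> simp <;> field_simp <;> ring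
  classical
  have hone : (bitMeasure (orthParam p) κ).real S =
      ∫ _ in S, (1 : ℝ) ∂bitMeasure (orthParam p) κ := by
    simp
  rw [hone, setIntegral_eq_sum, setIntegral_eq_sum, Finset.mul_sum]
  refine Finset.sum_congr rfl fun u _ => ?_
  by_cases hu : u ∈ S <;> simp [hu, hpoint]

theorem iIndepFun_bit :
    iIndepFun (fun (k : κ) (u : κ → Bool) => (if u k then 1 else 0) - (p : ℝ)) (bitMeasure p κ) :=
  iIndepFun_pi (X := fun _ (b : Bool) => (if b then 1 else 0) - (p : ℝ)) fun _ =>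
    (measurable_of_finite _).aemeasurable

theorem hasSubgaussianMGF_bit (k : κ) :
    HasSubgaussianMGF (fun u : κ → Bool => (if u k then 1 else 0) - (p : ℝ)) (1 / 4)
      (bitMeasure p κ) := by
  have hmean : ∫ u, (if u k then 1 else 0) ∂bitMeasure p κ = (p : ℝ) := by
    rw [bitMeasure, integral_comp_eval (μ := fun _ => bernoulliMeasure true false p) (i := k)
      (f := fun b : Bool => if b then (1 : ℝ) else 0) (measurable_of_finite _).aestronglyMeasurable,
      integral_bernoulliMeasure]
    simp
  have hsub := hasSubgaussianMGF_of_mem_Icc (μ := bitMeasure p κ) (a := 0) (b := 1)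
    (X := fun u => if u k then 1 else 0) (measurable_of_finite _).aemeasurable
    (.of_forall fun u => by split_ifs <;> simp)
  rw [hmean] at hsub
  convert! hsub using 1
  ext
  norm_num

theorem sum_bit_sub {κ : Type*} (u : κ → Bool) (A : Finset κ) (a : ℝ) :
    ∑ k ∈ A, ((if u k then 1 else 0) - a) = ones u A - a * A.card := by
  rw [Finset.sum_sub_distrib, ones, Finset.sum_boole, Finset.sum_const, nsmul_eq_mul, mul_comm]

theorem exp_hoeffding_eq (t : ℝ) (m : ℕ) :
    Real.exp (-(t * m) ^ 2 / (2 * (m * (1 / 4)))) = Real.exp (-2 * t ^ 2) ^ m := by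
  rw [← Real.exp_nat_mul]
  obtain rfl | hm := m.eq_zero_or_pos
  · simp
  · congr 1
    field_simp
    ring

theorem measureReal_le_ones_le (A : Finset κ) (ht : 0 ≤ t) :
    (bitMeasure p κ).real {u | (p + t) * A.card ≤ ones u A} ≤ Real.exp (-2 * t ^ 2) ^ A.card := by
  have htail := HasSubgaussianMGF.measure_sum_ge_le_of_iIndepFun (iIndepFun_bit (p := p) (κ := κ))
    (s := A) (fun k _ => hasSubgaussianMGF_bit k) (mul_nonneg ht A.card.cast_nonneg)
  calc _ = (bitMeasure p κ).real
          {u | t * A.card ≤ ∑ k ∈ A, ((if u k then 1 else 0) - (p : ℝ))} := by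
        simp only [sum_bit_sub, le_sub_iff_add_le', ← add_mul]
    _ ≤ _ := htail
    _ = Real.exp (-2 * t ^ 2) ^ A.card := by simpa using exp_hoeffding_eq t A.card

theorem measureReal_ones_le_le (A : Finset κ) (ht : 0 ≤ t) :
    (bitMeasure p κ).real {u | (ones u A : ℝ) ≤ (p - t) * A.card} ≤
      Real.exp (-2 * t ^ 2) ^ A.card := by
  have htail := HasSubgaussianMGF.measure_sum_ge_le_of_iIndepFun
    ((iIndepFun_bit (p := p) (κ := κ)).comp (fun _ => Neg.neg) fun _ => measurable_neg)
    (s := A) (fun k _ => (hasSubgaussianMGF_bit k).neg) (mul_nonneg ht A.card.cast_nonneg)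
  calc _ = (bitMeasure p κ).real
          {u | t * A.card ≤ ∑ k ∈ A, -((if u k then 1 else 0) - (p : ℝ))} := by
        simp only [Finset.sum_neg_distrib, sum_bit_sub]
        simp only [neg_sub, le_sub_comm, sub_mul]
    _ ≤ _ := htail
    _ = Real.exp (-2 * t ^ 2) ^ A.card := by simpa using exp_hoeffding_eq t A.card

section Light

variable {ι : Type*} [Fintype ι] {B : ι → Finset κ} {s : ℕ} {θ : ℝ}

theorem measureReal_not_isLight_le (hB : ∀ c, (B c).card = s) (ht : 0 ≤ t) (hθ : p + t ≤ θ) :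
    (bitMeasure p κ).real {u | ¬ IsLight B θ u} ≤
      Fintype.card ι * Real.exp (-2 * t ^ 2) ^ s := by
  have hsub : {u | ¬ IsLight B θ u} ⊆
      ⋃ c ∈ Finset.univ, {u | (p + t) * (B c).card ≤ ones u (B c)} := by
    intro u hu
    obtain ⟨c, hc⟩ := not_forall.1 hu
    simp only [Finset.mem_univ, Set.iUnion_true, Set.mem_iUnion, Set.mem_ofPred_eq]
    exact ⟨c, (by gcongr : (p + t) * ((B c).card : ℝ) ≤ θ * (B c).card).trans (not_le.1 hc).le⟩
  calc _ ≤ ∑ c, (bitMeasure p κ).real {u | (p + t) * (B c).card ≤ ones u (B c)} :=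
        (measureReal_mono hsub (measure_ne_top _ _)).trans (measureReal_biUnion_finset_le _ _)
    _ ≤ ∑ _ : ι, Real.exp (-2 * t ^ 2) ^ s :=
        Finset.sum_le_sum fun c _ => hB c ▸ measureReal_le_ones_le (B c) ht
    _ = Fintype.card ι * Real.exp (-2 * t ^ 2) ^ s := by simp

theorem measureReal_isLight_le (hdisj : Pairwise (Function.onFun Disjoint B))
    (hB : ∀ c, (B c).card = s) (ht : 0 ≤ t) (hθ : θ ≤ p - t) :
    (bitMeasure p κ).real {u | IsLight B θ u} ≤ Real.exp (-2 * t ^ 2) ^ (Fintype.card ι * s) := by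
  have hd : ((Finset.univ : Finset ι) : Set ι).PairwiseDisjoint B := hdisj.set_pairwise _
  set A := Finset.univ.disjiUnion B hd with hA
  have hcard : A.card = Fintype.card ι * s := by
    simp [hA, Finset.card_disjiUnion, hB]
  have hones (u : κ → Bool) : ones u A = ∑ c, ones u (B c) := by
    simp only [ones, hA, Finset.filter_disjiUnion, Finset.card_disjiUnion]
  rw [← hcard]
  refine (measureReal_mono fun u hu => ?_).trans (measureReal_ones_le_le A ht)
  calc (ones u A : ℝ) = ∑ c, (ones u (B c) : ℝ) := by rw [hones, Nat.cast_sum]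
    _ ≤ ∑ c, θ * (B c).card := Finset.sum_le_sum fun c _ => hu c
    _ = θ * A.card := by rw [hA, Finset.card_disjiUnion, Nat.cast_sum, Finset.mul_sum]
    _ ≤ (p - t) * A.card := by gcongr

end Light

end RandomVectors

section OVMeasure

variable {n d : ℕ} {p : unitInterval} {i j l : Fin n}

instance : IsProbabilityMeasure (ovMeasure p n d) := by
  unfold ovMeasure
  infer_instance

theorem ovMeasure_eq_pi : ovMeasure p n d = Measure.pi fun _ => bitMeasure p (Fin d) := rfl

theorem measureReal_mem_inter_disjoint (hij : i ≠ j) (S : Set (Fin d → Bool)) :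
    (ovMeasure p n d).real {x | x i ∈ S ∧ Disjoint (x i) (x j)} =
      (1 - (p : ℝ) ^ 2) ^ d * (bitMeasure (orthParam p) (Fin d)).real S := by
  have h := measureReal_eval_fibre (ν := bitMeasure p (Fin d)) (i := i) (J := {j}) (by simpa) S
    fun _ u => {v | Disjoint u v}
  simpa [ovMeasure_eq_pi, measureReal_disjoint, setIntegral_pow_ones] using h

theorem measureReal_disjoint_pair (hij : i ≠ j) :
    (ovMeasure p n d).real {x | Disjoint (x i) (x j)} = (1 - (p : ℝ) ^ 2) ^ d := by
  simpa using measureReal_mem_inter_disjoint (p := p) (d := d) hij Set.univ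

theorem measureReal_disjoint_inter_mem (hij : i ≠ j) (hil : i ≠ l) (hjl : j ≠ l)
    (S : Set (Fin d → Bool)) :
    (ovMeasure p n d).real {x | Disjoint (x i) (x j) ∧ x l ∈ S} =
      (1 - (p : ℝ) ^ 2) ^ d * (bitMeasure p (Fin d)).real S := by
  have h := measureReal_eval_fibre (ν := bitMeasure p (Fin d)) (i := i) (J := {j, l})
    (by simp [hij, hil]) Set.univ fun a u => if a = j then {v | Disjoint u v} else S
  simp only [Finset.prod_pair hjl, if_true, hjl.symm, if_false, measureReal_disjoint,
    integral_mul_const, setIntegral_pow_ones] at h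
  simpa [ovMeasure_eq_pi, hjl.symm] using h

theorem measureReal_mem_inter_disjoint_inter_disjoint_le (hij : i ≠ j) (hil : i ≠ l) (hjl : j ≠ l)
    {S : Set (Fin d → Bool)} {r : ℝ} (hr : ∀ u ∈ S, (1 - p : ℝ) ^ ones u Finset.univ ≤ r)
    (hr0 : 0 ≤ r) :
    (ovMeasure p n d).real {x | x i ∈ S ∧ Disjoint (x i) (x j) ∧ Disjoint (x i) (x l)} ≤
      (1 - (p : ℝ) ^ 2) ^ d * r := by
  have h := measureReal_eval_fibre (ν := bitMeasure p (Fin d)) (i := i) (J := {j, l})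
    (by simp [hij, hil]) S fun _ u => {v | Disjoint u v}
  simp only [Finset.prod_pair hjl, measureReal_disjoint, Finset.forall_mem_insert,
    Finset.mem_singleton, forall_eq, Set.mem_ofPred_eq, ← ovMeasure_eq_pi] at h
  have hp : (0 : ℝ) ≤ 1 - p := by linarith [p.2.2]
  have hq : (0 : ℝ) ≤ 1 - (p : ℝ) ^ 2 := by nlinarith [p.2.1, p.2.2]
  calc _ = ∫ u in S, (1 - p : ℝ) ^ ones u Finset.univ * (1 - p : ℝ) ^ ones u Finset.univ
          ∂bitMeasure p (Fin d) := h
    _ ≤ ∫ u in S, (1 - p : ℝ) ^ ones u Finset.univ * r ∂bitMeasure p (Fin d) :=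
        setIntegral_mono_on
          Integrable.of_finite.integrableOn Integrable.of_finite.integrableOn .of_discrete
          fun u hu => mul_le_mul_of_nonneg_left (hr u hu) (pow_nonneg hp _)
    _ = (1 - (p : ℝ) ^ 2) ^ d * (bitMeasure (orthParam p) (Fin d)).real S * r := by
        rw [integral_mul_const, setIntegral_pow_ones, Fintype.card_fin]
    _ ≤ (1 - (p : ℝ) ^ 2) ^ d * r := by
        gcongr
        exact mul_le_of_le_one_right (pow_nonneg hq d) measureReal_le_one

theorem indepFun_pairs {i' j' : Fin n} (h₁ : i ≠ i') (h₂ : i ≠ j') (h₃ : j ≠ i') (h₄ : j ≠ j') :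
    IndepFun (fun x : OVInstance n d => (x i, x j)) (fun x => (x i', x j')) (ovMeasure p n d) :=
  iIndepFun_eval_pi.indepFun_prodMk_prodMk (fun _ => measurable_pi_apply _) i j i' j' h₁ h₂ h₃ h₄

end OVMeasure

section SecondMoment

variable {Ω : Type*} [MeasurableSpace Ω] {μ : Measure Ω} [IsProbabilityMeasure μ]

theorem measureReal_forall_notMem_le {α : Type*} [Fintype α] {A : α → Set Ω}
    (hA : ∀ a, MeasurableSet (A a)) (hpos : 0 < ∑ a, μ.real (A a)) :
    μ.real {ω | ∀ a, ω ∉ A a} ≤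
      (∑ a, ∑ b, (μ.real (A a ∩ A b) - μ.real (A a) * μ.real (A b))) /
        (∑ a, μ.real (A a)) ^ 2 := by
  set X : α → Ω → ℝ := fun a => (A a).indicator 1
  have hmem (a : α) : MemLp (X a) 2 μ :=
    memLp_indicator_const 2 (hA a) 1 (.inr (measure_ne_top _ _))
  have hmean (a : α) : μ[X a] = μ.real (A a) := integral_indicator_one (hA a)
  have hcov (a b : α) :
      cov[X a, X b; μ] = μ.real (A a ∩ A b) - μ.real (A a) * μ.real (A b) := by
    rw [covariance_eq_sub (hmem a) (hmem b), hmean, hmean,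
      show X a * X b = (A a ∩ A b).indicator 1 from (Set.inter_indicator_one ..).symm,
      integral_indicator_one ((hA a).inter (hA b))]
  have hsum : μ[∑ a, X a] = ∑ a, μ.real (A a) := by
    simp only [Finset.sum_apply, integral_finsetSum _ fun a _ => (hmem a).integrable one_le_two,
      hmean]
  have hvar : Var[∑ a, X a; μ] =
      ∑ a, ∑ b, (μ.real (A a ∩ A b) - μ.real (A a) * μ.real (A b)) := by
    simp only [variance_sum hmem, hcov]
  have hcheb := meas_ge_le_variance_div_sq (memLp_finsetSum' Finset.univ fun a _ => hmem a) hpos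
  have hsub : {ω | ∀ a, ω ∉ A a} ⊆
      {ω | ∑ a, μ.real (A a) ≤ |(∑ a, X a) ω - ∑ a, μ.real (A a)|} := by
    intro ω hω
    have hzero : (∑ a, X a) ω = 0 := by
      rw [Finset.sum_apply]
      exact Finset.sum_eq_zero fun a _ => Set.indicator_of_notMem (hω a) _
    rw [Set.mem_ofPred_eq, hzero, zero_sub, abs_neg, abs_of_pos hpos]
  rw [hsum] at hcheb
  rw [← hvar]
  exact ENNReal.toReal_le_of_le_ofReal (div_nonneg (variance_nonneg _ _) (sq_nonneg _))
    ((measure_mono hsub).trans hcheb)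

theorem measureReal_grid_forall_notMem_le {ι : Type*} [Fintype ι] [Nonempty ι]
    {A : ι × ι → Set Ω} {r : ℝ} (hr : 0 < r) (hA : ∀ a, MeasurableSet (A a))
    (hge : ∀ a, r ^ 2 / 2 ≤ μ.real (A a)) (hle : ∀ a, μ.real (A a) ≤ r ^ 2)
    (hrow : ∀ i j j', j ≠ j' → μ.real (A (i, j) ∩ A (i, j')) ≤ r ^ 3)
    (hcol : ∀ i i' j, i ≠ i' → μ.real (A (i, j) ∩ A (i', j)) ≤ r ^ 3)
    (hind : ∀ i i' j j', i ≠ i' → j ≠ j' → IndepSet (A (i, j)) (A (i', j')) μ) :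
    μ.real {ω | ∀ a, ω ∉ A a} ≤ 8 / (Fintype.card ι * r) + 4 / (Fintype.card ι * r) ^ 2 := by
  classical
  set h : ℝ := (Fintype.card ι : ℝ)
  have hh : 0 < h := by simp [h, Fintype.card_pos]
  have hcov (i j i' j' : ι) :
      μ.real (A (i, j) ∩ A (i', j')) - μ.real (A (i, j)) * μ.real (A (i', j')) ≤
        (if i = i' ∧ j = j' then r ^ 2 else 0) +
          ((if i = i' then r ^ 3 else 0) + if j = j' then r ^ 3 else 0) := by
    have hmul : 0 ≤ μ.real (A (i, j)) * μ.real (A (i', j')) := by positivity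
    by_cases hi : i = i' <;> by_cases hj : j = j'
    · subst hi hj
      have := hle (i, j)
      simp
      nlinarith [pow_pos hr 3]
    · subst hi
      simpa [hj] using (hrow i j j' hj).trans (by linarith)
    · subst hj
      simpa [hi] using (hcol i i' j hi).trans (by linarith)
    · simp [hi, hj, measureReal_def, (hind i i' j j' hi hj).measure_inter_eq_mul]
  have hnum : ∑ a, ∑ b, (μ.real (A a ∩ A b) - μ.real (A a) * μ.real (A b)) ≤
      h ^ 2 * (r ^ 2 + 2 * h * r ^ 3) := by
    simp only [Fintype.sum_prod_type]
    refine (Finset.sum_le_sum fun i _ => Finset.sum_le_sum fun j _ =>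
      Finset.sum_le_sum fun i' _ => Finset.sum_le_sum fun j' _ => hcov i j i' j').trans_eq ?_
    simp [Finset.sum_add_distrib, ite_and, h]
    ring
  have hden : h ^ 2 * (r ^ 2 / 2) ≤ ∑ a, μ.real (A a) := by
    refine le_trans ?_ (Finset.sum_le_sum fun a _ => hge a)
    simp [h, sq]
  have hden0 : 0 < h ^ 2 * (r ^ 2 / 2) := by positivity
  calc _ ≤ _ := measureReal_forall_notMem_le hA (hden0.trans_le hden)
    _ ≤ h ^ 2 * (r ^ 2 + 2 * h * r ^ 3) / (h ^ 2 * (r ^ 2 / 2)) ^ 2 := by gcongr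
    _ = 8 / (h * r) + 4 / (h * r) ^ 2 := by
      field_simp
      ring

end SecondMoment

section OVMeasure

variable {n d : ℕ} {p : unitInterval} {i j l : Fin n} {G : Set (Fin d → Bool)} {r : ℝ}

theorem le_measureReal_mem_disjoint_mem (hij : i ≠ j) (hr : r ^ 2 = (1 - (p : ℝ) ^ 2) ^ d)
    (hG : (bitMeasure (orthParam p) (Fin d)).real Gᶜ ≤ 1 / 4) :
    r ^ 2 / 2 ≤ (ovMeasure p n d).real {x | x i ∈ G ∧ x j ∈ G ∧ Disjoint (x i) (x j)} := by
  set P := ovMeasure p n d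
  have hsub : {x : OVInstance n d | Disjoint (x i) (x j)} ⊆
      {x | x i ∈ G ∧ x j ∈ G ∧ Disjoint (x i) (x j)} ∪
        ({x | x i ∈ Gᶜ ∧ Disjoint (x i) (x j)} ∪ {x | x j ∈ Gᶜ ∧ Disjoint (x j) (x i)}) := by
    intro x hx
    simp only [Set.mem_union, Set.mem_ofPred_eq, Set.mem_compl_iff,
      disjoint_comm (a := x j)] at hx ⊢
    tauto
  have hunion := (measureReal_mono hsub).trans <| (measureReal_union_le _ _).trans <|
    add_le_add_right (measureReal_union_le (μ := P) _ _) _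
  rw [measureReal_disjoint_pair hij, measureReal_mem_inter_disjoint hij,
    measureReal_mem_inter_disjoint hij.symm, ← hr] at hunion
  nlinarith [sq_nonneg r]

theorem measureReal_grid_forall_not_disjoint_le {ι : Type*} [Fintype ι] [Nonempty ι]
    (e : ι ⊕ ι ↪ Fin n) (hr0 : 0 < r) (hr : r ^ 2 = (1 - (p : ℝ) ^ 2) ^ d)
    (hG : ∀ u ∈ G, (1 - p : ℝ) ^ ones u Finset.univ ≤ r)
    (hG' : (bitMeasure (orthParam p) (Fin d)).real Gᶜ ≤ 1 / 4) :
    (ovMeasure p n d).real {x | ∀ a b, ¬ (x (e (.inl a)) ∈ G ∧ x (e (.inr b)) ∈ G ∧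
        Disjoint (x (e (.inl a))) (x (e (.inr b))))} ≤
      8 / (Fintype.card ι * r) + 4 / (Fintype.card ι * r) ^ 2 := by
  have hLR (a b) : e (.inl a) ≠ e (.inr b) := e.injective.ne Sum.inl_ne_inr
  have hLL (a b) (hab : a ≠ b) : e (.inl a) ≠ e (.inl b) :=
    e.injective.ne (Sum.inl_injective.ne hab)
  have hRR (a b) (hab : a ≠ b) : e (.inr a) ≠ e (.inr b) :=
    e.injective.ne (Sum.inr_injective.ne hab)
  let T : Set ((Fin d → Bool) × (Fin d → Bool)) := {z | z.1 ∈ G ∧ z.2 ∈ G ∧ Disjoint z.1 z.2}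
  let A : ι × ι → Set (OVInstance n d) := fun a => {x | (x (e (.inl a.1)), x (e (.inr a.2))) ∈ T}
  have hle (a) : (ovMeasure p n d).real (A a) ≤ r ^ 2 := by
    rw [hr, ← measureReal_disjoint_pair (hLR a.1 a.2)]
    exact measureReal_mono fun x hx => hx.2.2
  have hrow (a b b') (hb : b ≠ b') : (ovMeasure p n d).real (A (a, b) ∩ A (a, b')) ≤ r ^ 3 := by
    rw [pow_succ, hr]
    refine le_trans (measureReal_mono ?_) (measureReal_mem_inter_disjoint_inter_disjoint_le
      (hLR a b) (hLR a b') (hRR b b' hb) hG hr0.le)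
    exact fun x hx => ⟨hx.1.1, hx.1.2.2, hx.2.2.2⟩
  have hcol (a a' b) (ha : a ≠ a') : (ovMeasure p n d).real (A (a, b) ∩ A (a', b)) ≤ r ^ 3 := by
    rw [pow_succ, hr]
    refine le_trans (measureReal_mono ?_) (measureReal_mem_inter_disjoint_inter_disjoint_le
      (hLR a b).symm (hLR a' b).symm (hLL a a' ha) hG hr0.le)
    exact fun x hx => ⟨hx.1.2.1, hx.1.2.2.symm, hx.2.2.2.symm⟩
  have hind (a a' b b') (ha : a ≠ a') (hb : b ≠ b') :
      IndepSet (A (a, b)) (A (a', b')) (ovMeasure p n d) :=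
    (indepFun_iff_indepSet_preimage (by fun_prop) (by fun_prop)).1
      (indepFun_pairs (hLL a a' ha) (hLR a b') (hLR a' b).symm (hRR b b' hb)) T T
      .of_discrete .of_discrete
  refine (measureReal_mono fun x hx a => ?_).trans (measureReal_grid_forall_notMem_le (A := A) hr0
    (fun _ => .of_discrete) (fun a => le_measureReal_mem_disjoint_mem (hLR a.1 a.2) hr hG') hle hrow
    hcol hind)
  exact hx a.1 a.2

theorem measureReal_forall_not_disjoint_le {V : Finset (Fin n)} {h : ℕ} (hh : 1 ≤ h)
    (hV : 2 * h ≤ V.card) (hr0 : 0 < r) (hr : r ^ 2 = (1 - (p : ℝ) ^ 2) ^ d)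
    (hG : ∀ u ∈ G, (1 - p : ℝ) ^ ones u Finset.univ ≤ r)
    (hG' : (bitMeasure (orthParam p) (Fin d)).real Gᶜ ≤ 1 / 4) :
    (ovMeasure p n d).real
        {x | ∀ i ∈ V, ∀ j ∈ V, i ≠ j → x i ∈ G → x j ∈ G → ¬ Disjoint (x i) (x j)} ≤
      8 / (h * r) + 4 / (h * r) ^ 2 := by
  have := Fin.pos_iff_nonempty.1 hh
  obtain ⟨e⟩ : Nonempty (Fin h ⊕ Fin h ↪ V) :=
    Function.Embedding.nonempty_of_card_le (by simpa [← two_mul] using hV)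
  have hgrid := measureReal_grid_forall_not_disjoint_le
    (e.trans (Function.Embedding.subtype (· ∈ V))) hr0 hr hG hG'
  rw [Fintype.card_fin] at hgrid
  refine (measureReal_mono fun x hx a b => ?_).trans hgrid
  rintro ⟨ha, hb, hab⟩
  exact hx _ (e _).2 _ (e _).2 (Subtype.val_injective.ne (e.injective.ne Sum.inl_ne_inr)) ha hb hab

end OVMeasure

section ErrorBounds

variable {n d b s w : ℕ} {p : unitInterval} {B : Fin s → Finset (Fin d)} {θ t : ℝ}
  {V : Finset (Fin n)} {f : Fin n → Fin b}

theorem one_sub_sq_nonneg : (0 : ℝ) ≤ 1 - (p : ℝ) ^ 2 := by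
  nlinarith [p.2.1, p.2.2]

theorem measureReal_exists_pair_le {A : Fin n × Fin n → Set (OVInstance n d)} {c : ℝ}
    (hA : ∀ i j, i ≠ j → (ovMeasure p n d).real (A (i, j)) ≤ c) (hc : 0 ≤ c) :
    (ovMeasure p n d).real {x | ∃ i ∈ V, ∃ j ∈ V, i ≠ j ∧ x ∈ A (i, j)} ≤ V.card ^ 2 * c := by
  have hsub : {x | ∃ i ∈ V, ∃ j ∈ V, i ≠ j ∧ x ∈ A (i, j)} ⊆ ⋃ a ∈ V.offDiag, A a := by
    rintro x ⟨i, hi, j, hj, hij, hx⟩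
    exact Set.mem_biUnion (Finset.mem_offDiag.2 ⟨hi, hj, hij⟩) hx
  have hcard : (V.offDiag.card : ℝ) ≤ V.card ^ 2 := by
    exact_mod_cast card_offDiag_le le_rfl
  calc _ ≤ ∑ a ∈ V.offDiag, (ovMeasure p n d).real (A a) :=
        (measureReal_mono hsub (measure_ne_top _ _)).trans (measureReal_biUnion_finset_le _ _)
    _ ≤ ∑ _ ∈ V.offDiag, c :=
        Finset.sum_le_sum fun a ha => hA _ _ (Finset.mem_offDiag.1 ha).2.2
    _ ≤ V.card ^ 2 * c := by
        rw [Finset.sum_const, nsmul_eq_mul]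
        gcongr

theorem measureReal_hasOrthogonalPair_le :
    (ovMeasure p n d).real {x | x.HasOrthogonalPair} ≤ n ^ 2 * (1 - (p : ℝ) ^ 2) ^ d := by
  have h := measureReal_exists_pair_le (p := p) (V := Finset.univ)
    (A := fun a : Fin n × Fin n => {x : OVInstance n d | Disjoint (x a.1) (x a.2)})
    (fun i j hij => (measureReal_disjoint_pair hij).le) (pow_nonneg one_sub_sq_nonneg d)
  simpa [OVInstance.hasOrthogonalPair_iff] using h

theorem measureReal_exists_disjoint_not_isLight_le (hB : ∀ c, (B c).card = s) (ht : 0 ≤ t)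
    (hθ : orthParam p + t ≤ θ) :
    (ovMeasure p n d).real
        {x | ∃ i ∈ V, ∃ j ∈ V, i ≠ j ∧ ¬ IsLight B θ (x i) ∧ Disjoint (x i) (x j)} ≤
      V.card ^ 2 * (1 - (p : ℝ) ^ 2) ^ d * (s * Real.exp (-2 * t ^ 2) ^ s) := by
  have hq := pow_nonneg (one_sub_sq_nonneg (p := p)) d
  rw [mul_assoc]
  refine measureReal_exists_pair_le (A := fun a => {x | ¬ IsLight B θ (x a.1) ∧
    Disjoint (x a.1) (x a.2)}) (fun i j hij => ?_) (by positivity)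
  refine (measureReal_mem_inter_disjoint hij {u | ¬ IsLight B θ u}).trans_le ?_
  gcongr
  simpa using measureReal_not_isLight_le hB ht hθ

theorem measureReal_disjoint_exists_mem_le {i j : Fin n} (hij : i ≠ j) (J : Finset (Fin n))
    (S : Set (Fin d → Bool)) :
    (ovMeasure p n d).real {x | Disjoint (x i) (x j) ∧ ∃ l ∈ J, l ≠ i ∧ l ≠ j ∧ x l ∈ S} ≤
      J.card * ((1 - (p : ℝ) ^ 2) ^ d * (bitMeasure p (Fin d)).real S) := by
  have hsub : {x : OVInstance n d | Disjoint (x i) (x j) ∧ ∃ l ∈ J, l ≠ i ∧ l ≠ j ∧ x l ∈ S} ⊆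
      ⋃ l ∈ J, {x | l ≠ i ∧ l ≠ j ∧ Disjoint (x i) (x j) ∧ x l ∈ S} := by
    rintro x ⟨hx, l, hl, hli, hlj, hS⟩
    exact Set.mem_biUnion hl ⟨hli, hlj, hx, hS⟩
  refine (measureReal_mono hsub (measure_ne_top _ _)).trans
    ((measureReal_biUnion_finset_le _ _).trans ?_)
  rw [← nsmul_eq_mul]
  refine Finset.sum_le_card_nsmul _ _ _ fun l _ => ?_
  by_cases hl : l ≠ i ∧ l ≠ j
  · refine (measureReal_mono fun x hx => hx.2.2).trans_eq
      (measureReal_disjoint_inter_mem hij hl.1.symm hl.2.symm S)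
  · have hempty : {x : OVInstance n d | l ≠ i ∧ l ≠ j ∧ Disjoint (x i) (x j) ∧ x l ∈ S} = ∅ :=
      Set.eq_empty_of_forall_notMem fun x hx => hl ⟨hx.1, hx.2.1⟩
    rw [hempty, measureReal_empty]
    exact mul_nonneg (pow_nonneg one_sub_sq_nonneg d) measureReal_nonneg

theorem measureReal_exists_collision_le (hdisj : Pairwise (Function.onFun Disjoint B))
    (hB : ∀ c, (B c).card = s) (ht : 0 ≤ t) (hθ : θ ≤ p - t)
    (hf : ∀ c, (BoolFormula.bucket V f c).card ≤ w) :
    (ovMeasure p n d).real {x | ∃ i ∈ V, ∃ j ∈ V, i ≠ j ∧ Disjoint (x i) (x j) ∧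
        ∃ l ∈ BoolFormula.bucket V f (f i), l ≠ i ∧ l ≠ j ∧ IsLight B θ (x l)} ≤
      V.card ^ 2 * (1 - (p : ℝ) ^ 2) ^ d * (w * Real.exp (-2 * t ^ 2) ^ (s * s)) := by
  have hq := pow_nonneg (one_sub_sq_nonneg (p := p)) d
  rw [mul_assoc]
  refine measureReal_exists_pair_le (A := fun a => {x | Disjoint (x a.1) (x a.2) ∧
    ∃ l ∈ BoolFormula.bucket V f (f a.1), l ≠ a.1 ∧ l ≠ a.2 ∧ IsLight B θ (x l)})
    (fun i j hij => ?_) (by positivity)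
  refine (measureReal_disjoint_exists_mem_le hij _ {u | IsLight B θ u}).trans ?_
  rw [mul_left_comm]
  have hlight := measureReal_isLight_le (p := p) hdisj hB ht hθ
  rw [Fintype.card_fin] at hlight
  have := hf (f i)
  gcongr

theorem measureReal_searchFormula_error_le (hdisj : Pairwise (Function.onFun Disjoint B))
    (hB : ∀ c, (B c).card = s) (ht : 0 ≤ t) (hθ : θ ≤ p - t)
    (hf : ∀ c, (BoolFormula.bucket V f c).card ≤ w) :
    (ovMeasure p n d).real {x | ¬ ((searchFormula B θ V f).output x = true ↔
        x.HasOrthogonalPair)} ≤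
      (ovMeasure p n d).real {x | x.HasOrthogonalPair ∧ ∀ i ∈ V, ∀ j ∈ V, i ≠ j →
          IsLight B θ (x i) → IsLight B θ (x j) → ¬ Disjoint (x i) (x j)} +
        V.card ^ 2 * (1 - (p : ℝ) ^ 2) ^ d * (w * Real.exp (-2 * t ^ 2) ^ (s * s)) := by
  refine le_trans ((measureReal_mono (fun x hx => ?_) (measure_ne_top _ _)).trans
    (measureReal_union_le _ _))
    (add_le_add_right (measureReal_exists_collision_le hdisj hB ht hθ hf) _)
  have hno : ¬ (searchFormula B θ V f).output x = true := fun h =>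
    hx ⟨fun _ => hasOrthogonalPair_of_output_searchFormula h, fun _ => h⟩
  have hyes : x.HasOrthogonalPair := by
    by_contra h
    exact hx ⟨fun h' => absurd h' hno, fun h' => absurd h' h⟩
  by_contra! hx'
  simp only [Set.mem_union, Set.mem_ofPred_eq, not_or, not_and, not_forall, not_not, not_exists,
    BoolFormula.mem_bucket] at hx'
  obtain ⟨hpair, hcoll⟩ := hx'
  obtain ⟨i, hi, j, hj, hij, hLi, hLj, hd⟩ := hpair hyes
  refine hno (output_searchFormula_of_isolated hij hd hi hj hLi hLj fun l hl hli hlj hfl => ?_)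
  rcases hfl with hfl | hfl
  · exact hcoll i hi j hj hij hd l ⟨hl, hfl⟩ hli hlj
  · exact hcoll j hj i hi hij.symm hd.symm l ⟨hl, hfl⟩ hlj hli

theorem measureReal_searchFormula_univ_error_le (hdisj : Pairwise (Function.onFun Disjoint B))
    (hB : ∀ c, (B c).card = s) (ht : 0 ≤ t) (hαθ : orthParam p + t ≤ θ) (hθp : θ ≤ p - t)
    (hf : ∀ c, (BoolFormula.bucket Finset.univ f c).card ≤ w) :
    (ovMeasure p n d).real {x | ¬ ((searchFormula B θ Finset.univ f).output x = true ↔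
        x.HasOrthogonalPair)} ≤
      n ^ 2 * (1 - (p : ℝ) ^ 2) ^ d *
        (s * Real.exp (-2 * t ^ 2) ^ s + w * Real.exp (-2 * t ^ 2) ^ (s * s)) := by
  have hsub : {x : OVInstance n d | x.HasOrthogonalPair ∧ ∀ i ∈ Finset.univ, ∀ j ∈ Finset.univ,
      i ≠ j → IsLight B θ (x i) → IsLight B θ (x j) → ¬ Disjoint (x i) (x j)} ⊆
      {x | ∃ i ∈ Finset.univ, ∃ j ∈ Finset.univ, i ≠ j ∧ ¬ IsLight B θ (x i) ∧
        Disjoint (x i) (x j)} := by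
    rintro x ⟨hx, hpair⟩
    obtain ⟨i, j, hij, hd⟩ := x.hasOrthogonalPair_iff.1 hx
    by_cases hLi : IsLight B θ (x i)
    · exact ⟨j, by simp, i, by simp, hij.symm,
        fun hLj => hpair i (by simp) j (by simp) hij hLi hLj hd, hd.symm⟩
    · exact ⟨i, by simp, j, by simp, hij, hLi, hd⟩
  have herr := (measureReal_searchFormula_error_le (p := p) hdisj hB ht hθp hf).trans
    (add_le_add_left ((measureReal_mono hsub).trans
      (measureReal_exists_disjoint_not_isLight_le hB ht hαθ)) _)
  rwa [Finset.card_fin, ← mul_add] at herr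

theorem measureReal_searchFormula_subset_error_le (hdisj : Pairwise (Function.onFun Disjoint B))
    (hB : ∀ c, (B c).card = s) (ht : 0 ≤ t) (hαθ : orthParam p + t ≤ θ) (hθp : θ ≤ p - t)
    (hf : ∀ c, (BoolFormula.bucket V f c).card ≤ w) {h : ℕ} {r : ℝ} (hh : 1 ≤ h)
    (hV : 2 * h ≤ V.card) (hp1 : (p : ℝ) < 1) (hr0 : 0 < r) (hr : r ^ 2 = (1 - (p : ℝ) ^ 2) ^ d)
    (hpr : (1 - p : ℝ) ^ ((orthParam p - t) * d) ≤ r)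
    (hsmall : s * Real.exp (-2 * t ^ 2) ^ s + Real.exp (-2 * t ^ 2) ^ d ≤ 1 / 4) :
    (ovMeasure p n d).real {x | ¬ ((searchFormula B θ V f).output x = true ↔
        x.HasOrthogonalPair)} ≤
      8 / (h * r) + 4 / (h * r) ^ 2 +
        V.card ^ 2 * (1 - (p : ℝ) ^ 2) ^ d * (w * Real.exp (-2 * t ^ 2) ^ (s * s)) := by
  set G : Set (Fin d → Bool) :=
    {u | IsLight B θ u ∧ ¬ (ones u Finset.univ : ℝ) ≤ (orthParam p - t) * d} with hG
  have hGr (u) (hu : u ∈ G) : (1 - p : ℝ) ^ ones u Finset.univ ≤ r := by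
    rw [← Real.rpow_natCast]
    exact (Real.rpow_le_rpow_of_exponent_ge (by linarith) (by linarith [p.2.1])
      (not_le.1 hu.2).le).trans hpr
  have hGc : (bitMeasure (orthParam p) (Fin d)).real Gᶜ ≤ 1 / 4 := by
    have hcompl : Gᶜ = {u | ¬ IsLight B θ u} ∪
        {u | (ones u Finset.univ : ℝ) ≤ (orthParam p - t) * d} := by
      rw [hG, Set.compl_ofPred]
      ext u
      simp only [Set.mem_ofPred_eq, Set.mem_union]
      tauto
    have hheavy := measureReal_not_isLight_le hB ht hαθ
    have hfew := measureReal_ones_le_le (p := orthParam p) (κ := Fin d) Finset.univ ht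
    rw [Fintype.card_fin] at hheavy
    rw [Finset.card_fin] at hfew
    rw [hcompl]
    exact (measureReal_union_le _ _).trans ((add_le_add hheavy hfew).trans hsmall)
  refine (measureReal_searchFormula_error_le hdisj hB ht hθp hf).trans (add_le_add_left ?_ _)
  refine (measureReal_mono fun x hx => ?_).trans
    (measureReal_forall_not_disjoint_le hh hV hr0 hr hGr hGc)
  exact fun i hi j hj hij hiG hjG => hx.2 i hi j hj hij hiG.1 hjG.1

end ErrorBounds

section HasSoundFormula

/-- There is a formula of size at most `S`, of bounded depth and without false positives, that
decides all instances except for an event of probability at most `e`. -/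
def HasSoundFormula (p : unitInterval) (n d : ℕ) (S e : ℝ) : Prop :=
  ∃ F : BoolFormula (Fin n × Fin d), F.depth ≤ 12 ∧ (F.size : ℝ) ≤ S ∧
    (∀ x : OVInstance n d, F.output x = true → x.HasOrthogonalPair) ∧
    (ovMeasure p n d).real {x | ¬ (F.output x = true ↔ x.HasOrthogonalPair)} ≤ e

variable {n d b s w : ℕ} {p : unitInterval} {t S e : ℝ}

theorem HasSoundFormula.mono {S' e' : ℝ} (h : HasSoundFormula p n d S e) (hS : S ≤ S')
    (he : e ≤ e') : HasSoundFormula p n d S' e' :=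
  let ⟨F, hdepth, hsize, hsound, herr⟩ := h
  ⟨F, hdepth, hsize.trans hS, hsound, herr.trans he⟩

theorem hasSoundFormula_const :
    HasSoundFormula p n d 1 ((ovMeasure p n d).real {x | x.HasOrthogonalPair}) :=
  ⟨.const false, by simp [BoolFormula.depth], by simp [BoolFormula.size],
    by simp [BoolFormula.output, BoolFormula.eval],
    by simp [BoolFormula.output, BoolFormula.eval]⟩

theorem hasSoundFormula_exhaustive (hn : 2 ≤ n) :
    HasSoundFormula p n d (2 ^ d * (2 * (n * (d * 2 + 1) + 1) + 1) + 1) 0 :=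
  ⟨.exhaustive n d, BoolFormula.depth_exhaustive_le.trans (by norm_num),
    by exact_mod_cast BoolFormula.size_exhaustive_le,
    fun x => (BoolFormula.output_exhaustive hn).1, by simp [BoolFormula.output_exhaustive hn]⟩

theorem hasSoundFormula_search_univ (ht : 0 ≤ t) (hgap : orthParam p + 2 * t ≤ p)
    (hs : s * s ≤ d) (hb : 1 ≤ b) (hw : 1 ≤ w) (hn : n ≤ b * w) :
    HasSoundFormula p n d (24 * (d + 1) ^ 2 * 2 ^ s * (b ^ 2 * w + b * w ^ 2))
      (n ^ 2 * (1 - (p : ℝ) ^ 2) ^ d *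
        (s * Real.exp (-2 * t ^ 2) ^ s + w * Real.exp (-2 * t ^ 2) ^ (s * s))) := by
  obtain ⟨B, hdisj, hB⟩ := exists_disjoint_blocks (κ := Fin d) (r := s) (s := s) (by simpa using hs)
  obtain ⟨f, hf⟩ := exists_fibres_card_le (V := (Finset.univ : Finset (Fin n))) hb
    (by simpa using hn)
  exact ⟨searchFormula B (orthParam p + t) Finset.univ f, depth_searchFormula_le,
    by exact_mod_cast size_searchFormula_le (fun c => (hB c).le) hs hf hb hw,
    fun x => hasOrthogonalPair_of_output_searchFormula,
    measureReal_searchFormula_univ_error_le hdisj hB ht le_rfl (by linarith) hf⟩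

theorem hasSoundFormula_search_subset (ht : 0 ≤ t) (hgap : orthParam p + 2 * t ≤ p)
    (hs : s * s ≤ d) (hb : 1 ≤ b) (hw : 1 ≤ w) {m : ℕ} {r : ℝ} (hmn : m ≤ n) (hm : m ≤ b * w)
    (hm2 : 2 ≤ m) (hp1 : (p : ℝ) < 1) (hr0 : 0 < r) (hr : r ^ 2 = (1 - (p : ℝ) ^ 2) ^ d)
    (hpr : (1 - p : ℝ) ^ ((orthParam p - t) * d) ≤ r)
    (hsmall : s * Real.exp (-2 * t ^ 2) ^ s + Real.exp (-2 * t ^ 2) ^ d ≤ 1 / 4) :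
    HasSoundFormula p n d (24 * (d + 1) ^ 2 * 2 ^ s * (b ^ 2 * w + b * w ^ 2))
      (8 / ((m / 2 : ℕ) * r) + 4 / ((m / 2 : ℕ) * r) ^ 2 +
        m ^ 2 * r ^ 2 * (w * Real.exp (-2 * t ^ 2) ^ (s * s))) := by
  obtain ⟨B, hdisj, hB⟩ := exists_disjoint_blocks (κ := Fin d) (r := s) (s := s) (by simpa using hs)
  obtain ⟨V, -, rfl⟩ := Finset.exists_subset_card_eq (s := (Finset.univ : Finset (Fin n)))
    (by simpa using hmn)
  obtain ⟨f, hf⟩ := exists_fibres_card_le hb hm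
  refine ⟨searchFormula B (orthParam p + t) V f, depth_searchFormula_le,
    by exact_mod_cast size_searchFormula_le (fun c => (hB c).le) hs hf hb hw,
    fun x => hasOrthogonalPair_of_output_searchFormula, ?_⟩
  rw [hr]
  exact measureReal_searchFormula_subset_error_le hdisj hB ht le_rfl (by linarith) hf
    (by omega) (by omega) hp1 hr0 hr hpr hsmall

end HasSoundFormula

section Parameters

variable {p : unitInterval}

theorem orthParam_lt (hp0 : 0 < (p : ℝ)) : (orthParam p : ℝ) < p := by
  rw [coe_orthParam]
  exact div_lt_self hp0 (by linarith)

-- After taking logarithms the claim is `-(1 - p) log (1 - p) < (1 + p) log (1 + p)`, and `p`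
-- separates the two sides.
theorem one_sub_rpow_orthParam_lt (hp0 : 0 < (p : ℝ)) (hp1 : (p : ℝ) < 1) :
    (1 - p : ℝ) ^ (orthParam p : ℝ) < √(1 - (p : ℝ) ^ 2) := by
  have h₁ : 0 < 1 - (p : ℝ) := by linarith
  have h₂ : 0 < 1 + (p : ℝ) := by linarith
  have hleft : -(1 - (p : ℝ)) * Real.log (1 - p) < p := by
    have hlog := Real.log_lt_sub_one_of_pos (inv_pos.2 h₁) (by simpa using hp0.ne')
    rw [Real.log_inv, lt_sub_iff_add_lt, inv_eq_one_div, lt_div_iff₀ h₁] at hlog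
    linarith
  have hright : (p : ℝ) ≤ (1 + p) * Real.log (1 + p) := by
    have hlog := Real.one_sub_inv_le_log_of_pos h₂
    calc (p : ℝ) = (1 + p) * (1 - (1 + p : ℝ)⁻¹) := by field_simp; ring
      _ ≤ _ := by gcongr
  rw [← Real.log_lt_log_iff (by positivity) (Real.sqrt_pos.2 (by nlinarith)), Real.log_rpow h₁,
    Real.log_sqrt (by nlinarith), show 1 - (p : ℝ) ^ 2 = (1 - p) * (1 + p) by ring,
    Real.log_mul h₁.ne' h₂.ne', coe_orthParam, div_mul_eq_mul_div, div_lt_div_iff₀ h₂ two_pos]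
  linarith

theorem exists_gap (hp0 : 0 < (p : ℝ)) (hp1 : (p : ℝ) < 1) :
    ∃ t > (0 : ℝ), orthParam p + 2 * t ≤ p ∧
      (1 - p : ℝ) ^ (orthParam p - t : ℝ) ≤ √(1 - (p : ℝ) ^ 2) := by
  have h₁ : 1 - (p : ℝ) ≠ 0 := by linarith
  have hcont₁ : Continuous fun t : ℝ => (orthParam p : ℝ) + 2 * t := by fun_prop
  have hcont₂ : Continuous fun t : ℝ => (1 - p : ℝ) ^ (orthParam p - t : ℝ) :=
    continuous_const.rpow (by fun_prop) fun _ => .inl h₁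
  have hgap : ∀ᶠ t in 𝓝[>] (0 : ℝ), (orthParam p : ℝ) + 2 * t < p :=
    (hcont₁.tendsto 0).mono_left nhdsWithin_le_nhds |>.eventually_lt_const
      (by simpa using orthParam_lt hp0)
  have hpow : ∀ᶠ t in 𝓝[>] (0 : ℝ), (1 - p : ℝ) ^ (orthParam p - t : ℝ) < √(1 - (p : ℝ) ^ 2) :=
    (hcont₂.tendsto 0).mono_left nhdsWithin_le_nhds |>.eventually_lt_const
      (by simpa using one_sub_rpow_orthParam_lt hp0 hp1)
  obtain ⟨t, ht, ht₁, ht₂⟩ := (eventually_mem_nhdsWithin.and (hgap.and hpow)).exists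
  exact ⟨t, ht, ht₁.le, ht₂.le⟩

end Parameters

section Sampling

variable {n d b s w : ℕ} {p : unitInterval} {t : ℝ}

theorem exists_sample_size {K r : ℝ} (hK : 1 < K) (hr0 : 0 < r) (hr1 : r ≤ 1) (h : K ≤ n * r) :
    ∃ m : ℕ, 2 ≤ m ∧ m ≤ n ∧ K / 4 ≤ (m / 2 : ℕ) * r ∧ m * r ≤ 2 * K := by
  have hquot : 1 < K / r := (one_lt_div hr0).2 (by linarith)
  have hlower : K / r ≤ ⌈K / r⌉₊ := Nat.le_ceil _
  have hupper : (⌈K / r⌉₊ : ℝ) ≤ 2 * (K / r) := Nat.ceil_le_two_mul (by linarith)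
  refine ⟨⌈K / r⌉₊, Nat.lt_ceil.2 (by simpa using hquot), Nat.ceil_le.2 ((div_le_iff₀ hr0).2 h),
    ?_, ?_⟩
  · have hhalf : 1 < ⌈K / r⌉₊ := Nat.lt_ceil.2 (by simpa using hquot)
    have hquarter : (⌈K / r⌉₊ : ℝ) ≤ 4 * (⌈K / r⌉₊ / 2 : ℕ) := by
      exact_mod_cast (by lia : ⌈K / r⌉₊ ≤ 4 * (⌈K / r⌉₊ / 2))
    rw [div_le_iff₀ hr0] at hlower
    nlinarith
  · rwa [mul_div_assoc', le_div_iff₀ hr0] at hupper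

theorem second_moment_error_le {K x : ℝ} (hK : 1 ≤ K) (hx : K / 4 ≤ x) :
    8 / x + 4 / x ^ 2 ≤ 96 / K := by
  calc 8 / x + 4 / x ^ 2 ≤ 8 / (K / 4) + 4 / (K / 4) ^ 2 := by gcongr
    _ = 32 / K + 64 / K ^ 2 := by field_simp; ring
    _ ≤ 32 / K + 64 / K ^ 1 := by gcongr; norm_num
    _ = 96 / K := by ring

theorem hasSoundFormula_search_of_few (ht : 0 ≤ t) (hgap : orthParam p + 2 * t ≤ p)
    (hs : s * s ≤ d) (hb : 1 ≤ b) (hw : 1 ≤ w) (hn : n ≤ b * w)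
    (hwlight : w * Real.exp (-2 * t ^ 2) ^ (s * s) ≤ 2 * Real.exp (-2 * t ^ 2) ^ s)
    (hfew : (n : ℝ) ^ 2 * (1 - (p : ℝ) ^ 2) ^ d ≤ (s + 2) ^ 2) :
    HasSoundFormula p n d (24 * (d + 1) ^ 2 * 2 ^ s * (b ^ 2 * w + b * w ^ 2))
      ((s + 2) ^ 3 * Real.exp (-2 * t ^ 2) ^ s) := by
  refine (hasSoundFormula_search_univ ht hgap hs hb hw hn).mono le_rfl ?_
  calc _ ≤ (s + 2 : ℝ) ^ 2 * (s * Real.exp (-2 * t ^ 2) ^ s + 2 * Real.exp (-2 * t ^ 2) ^ s) := by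
        gcongr
    _ = (s + 2) ^ 3 * Real.exp (-2 * t ^ 2) ^ s := by ring

theorem hasSoundFormula_search_of_many (ht : 0 ≤ t) (hgap : orthParam p + 2 * t ≤ p)
    (hs : s * s ≤ d) (hb : 1 ≤ b) (hw : 1 ≤ w) (hn : n ≤ b * w) (hp1 : (p : ℝ) < 1) {r : ℝ}
    (hr0 : 0 < r) (hr1 : r ≤ 1) (hr : r ^ 2 = (1 - (p : ℝ) ^ 2) ^ d)
    (hpr : (1 - p : ℝ) ^ ((orthParam p - t) * d) ≤ r)
    (hwlight : w * Real.exp (-2 * t ^ 2) ^ (s * s) ≤ 2 * Real.exp (-2 * t ^ 2) ^ s)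
    (hsmall : (s + 2 : ℝ) ^ 3 * Real.exp (-2 * t ^ 2) ^ s ≤ 1 / 4)
    (hmany : (s + 2 : ℝ) ≤ n * r) :
    HasSoundFormula p n d (24 * (d + 1) ^ 2 * 2 ^ s * (b ^ 2 * w + b * w ^ 2))
      (96 / (s + 2) + 8 * ((s + 2) ^ 3 * Real.exp (-2 * t ^ 2) ^ s)) := by
  set ρ := Real.exp (-2 * t ^ 2)
  have : (0 : ℝ) ≤ s := s.cast_nonneg
  have hρ0 : 0 < ρ := Real.exp_pos _
  have hρ1 : ρ ≤ 1 := Real.exp_le_one_iff.2 (by nlinarith [sq_nonneg t])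
  have hheavy : s * ρ ^ s + ρ ^ d ≤ 1 / 4 := by
    calc s * ρ ^ s + ρ ^ d ≤ s * ρ ^ s + ρ ^ s :=
          add_le_add_right (pow_le_pow_of_le_one hρ0.le hρ1 ((Nat.le_mul_self s).trans hs)) _
      _ = (s + 1) * ρ ^ s := by ring
      _ ≤ (s + 2) ^ 3 * ρ ^ s := by
          gcongr
          linarith [le_self_pow₀ (show (1 : ℝ) ≤ s + 2 by linarith) three_ne_zero]
      _ ≤ 1 / 4 := hsmall
  obtain ⟨m, hm2, hmn, hmlower, hmupper⟩ := exists_sample_size (by linarith) hr0 hr1 hmany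
  refine (hasSoundFormula_search_subset ht hgap hs hb hw hmn (hmn.trans hn) hm2 hp1 hr0 hr hpr
    hheavy).mono le_rfl ?_
  calc _ ≤ 96 / (s + 2 : ℝ) + (2 * (s + 2)) ^ 2 * (2 * ρ ^ s) := by
        rw [← mul_pow]
        gcongr
        exact second_moment_error_le (by linarith) hmlower
    _ ≤ 96 / (s + 2 : ℝ) + 8 * ((s + 2) ^ 3 * ρ ^ s) := by
        have hcube : (s + 2 : ℝ) ^ 2 ≤ (s + 2) ^ 3 :=
          pow_le_pow_right₀ (by linarith) (by norm_num)
        nlinarith [mul_le_mul_of_nonneg_right hcube (pow_pos hρ0 s).le]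

theorem hasSoundFormula_search (ht : 0 ≤ t) (hgap : orthParam p + 2 * t ≤ p)
    (hs : s * s ≤ d) (hb : 1 ≤ b) (hw : 1 ≤ w) (hn : n ≤ b * w) (hp1 : (p : ℝ) < 1)
    (hpow : (1 - p : ℝ) ^ (orthParam p - t : ℝ) ≤ √(1 - (p : ℝ) ^ 2))
    (hwlight : w * Real.exp (-2 * t ^ 2) ^ (s * s) ≤ 2 * Real.exp (-2 * t ^ 2) ^ s)
    (hsmall : (s + 2 : ℝ) ^ 3 * Real.exp (-2 * t ^ 2) ^ s ≤ 1 / 4) :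
    HasSoundFormula p n d (24 * (d + 1) ^ 2 * 2 ^ s * (b ^ 2 * w + b * w ^ 2))
      (96 / (s + 2) + 8 * ((s + 2) ^ 3 * Real.exp (-2 * t ^ 2) ^ s)) := by
  have hq : 0 < 1 - (p : ℝ) ^ 2 := by nlinarith [p.2.1]
  set r := √(1 - (p : ℝ) ^ 2) ^ d with hrdef
  have hr0 : 0 < r := by positivity
  have hr1 : r ≤ 1 := pow_le_one₀ (by positivity) (Real.sqrt_le_one.2 (by nlinarith))
  have hr : r ^ 2 = (1 - (p : ℝ) ^ 2) ^ d := by rw [hrdef, pow_right_comm, Real.sq_sqrt hq.le]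
  have hpr : (1 - p : ℝ) ^ ((orthParam p - t) * d) ≤ r := by
    rw [Real.rpow_mul (by linarith), Real.rpow_natCast]
    exact pow_le_pow_left₀ (by bound) hpow d
  -- The expected number of orthogonal pairs is of order `(n * r) ^ 2`.
  rcases le_or_gt (s + 2 : ℝ) (n * r) with hmany | hfew
  · exact hasSoundFormula_search_of_many ht hgap hs hb hw hn hp1 hr0 hr1 hr hpr hwlight hsmall hmany
  · refine (hasSoundFormula_search_of_few ht hgap hs hb hw hn hwlight ?_).mono le_rfl ?_
    · rw [← hr, ← mul_pow]
      gcongr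
    · have herr : 0 ≤ (s + 2 : ℝ) ^ 3 * Real.exp (-2 * t ^ 2) ^ s := by positivity
      have hmoment : 0 ≤ 96 / (s + 2 : ℝ) := by positivity
      linarith

theorem tendsto_search_error {ρ : ℝ} (hρ0 : 0 < ρ) (hρ1 : ρ < 1) :
    Tendsto (fun s : ℕ => 96 / (s + 2 : ℝ) + 8 * ((s + 2) ^ 3 * ρ ^ s)) atTop (𝓝 0) := by
  have hinv : Tendsto (fun s : ℕ => 96 / (s + 2 : ℝ)) atTop (𝓝 0) :=
    tendsto_const_nhds.div_atTop (tendsto_natCast_atTop_atTop.atTop_add tendsto_const_nhds)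
  have hpow : Tendsto (fun s : ℕ => (ρ ^ 2)⁻¹ * ((s + 2 : ℕ) ^ 3 * ρ ^ (s + 2))) atTop (𝓝 0) := by
    simpa using ((tendsto_add_atTop_iff_nat 2).2 (tendsto_pow_const_mul_const_pow_of_abs_lt_one 3
      (by rwa [abs_of_pos hρ0]))).const_mul ((ρ ^ 2)⁻¹)
  have heq (s : ℕ) : (ρ ^ 2)⁻¹ * ((s + 2 : ℕ) ^ 3 * ρ ^ (s + 2)) = (s + 2 : ℝ) ^ 3 * ρ ^ s := by
    rw [pow_add]
    push_cast
    field_simp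
  simpa only [heq, mul_zero, add_zero] using hinv.add (hpow.const_mul 8)

end Sampling

section BucketCount

variable {n d s : ℕ} {η : ℝ}

theorem le_div_add_one_mul (n : ℕ) {w : ℕ} (hw : 0 < w) : n ≤ (n / w + 1) * w :=
  (Nat.lt_mul_of_div_lt (Nat.lt_succ_self _) hw).le

theorem ceil_rpow_le_two_mul (hn : 1 ≤ n) (hη : 0 ≤ η) :
    (⌈(n : ℝ) ^ η⌉₊ : ℝ) ≤ 2 * (n : ℝ) ^ η :=
  Nat.ceil_le_two_mul (by linarith [Real.one_le_rpow (by exact_mod_cast hn : (1 : ℝ) ≤ n) hη])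

theorem bucket_count_le (hn : 1 ≤ n) (hη0 : 0 ≤ η) (hη : η ≤ 1 / 2) :
    (((n / ⌈(n : ℝ) ^ η⌉₊ + 1 : ℕ) : ℝ) ^ 2 * ⌈(n : ℝ) ^ η⌉₊ +
      (n / ⌈(n : ℝ) ^ η⌉₊ + 1 : ℕ) * (⌈(n : ℝ) ^ η⌉₊ : ℝ) ^ 2) ≤ 16 * (n : ℝ) ^ (2 - η) := by
  have hn1 : (1 : ℝ) ≤ n := by exact_mod_cast hn
  have hn0 : (0 : ℝ) < n := by linarith
  have hN1 : 1 ≤ (n : ℝ) ^ η := Real.one_le_rpow hn1 hη0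
  have hNn : ((n : ℝ) ^ η) ^ 2 ≤ n := by
    rw [← Real.rpow_mul_natCast hn0.le]
    exact (Real.rpow_le_rpow_of_exponent_le hn1 (by push_cast; linarith)).trans_eq
      (Real.rpow_one _)
  have hw := ceil_rpow_le_two_mul hn hη0
  have hNw : (n : ℝ) ^ η ≤ ⌈(n : ℝ) ^ η⌉₊ := Nat.le_ceil _
  rw [Real.rpow_sub hn0, Real.rpow_two]
  set N := (n : ℝ) ^ η
  set w := ⌈N⌉₊
  have hb : ((n / w + 1 : ℕ) : ℝ) ≤ 2 * (n / N) := by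
    have hdiv : ((n / w : ℕ) : ℝ) ≤ n / N := Nat.cast_div_le.trans (by gcongr)
    have hone : 1 ≤ n / N := (one_le_div (by positivity)).2 (by nlinarith)
    push_cast
    linarith
  calc ((n / w + 1 : ℕ) : ℝ) ^ 2 * w + (n / w + 1 : ℕ) * (w : ℝ) ^ 2
      ≤ (2 * (n / N)) ^ 2 * (2 * N) + 2 * (n / N) * (2 * N) ^ 2 := by gcongr
    _ = 8 * (n ^ 2 / N) + 8 * n * N ^ 2 / N := by field_simp; ring
    _ ≤ 8 * (n ^ 2 / N) + 8 * n * n / N := by gcongr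
    _ = 16 * (n ^ 2 / N) := by ring

theorem search_size_le (hn : 1 ≤ n) (hη0 : 0 ≤ η) (hη : η ≤ 1 / 2) (hds : d < (s + 1) * (s + 1))
    (h : 384 * (s + 1 : ℝ) ^ 4 * 2 ^ s ≤ (n : ℝ) ^ (η / 2)) :
    24 * (d + 1 : ℝ) ^ 2 * 2 ^ s * (((n / ⌈(n : ℝ) ^ η⌉₊ + 1 : ℕ) : ℝ) ^ 2 * ⌈(n : ℝ) ^ η⌉₊ +
      (n / ⌈(n : ℝ) ^ η⌉₊ + 1 : ℕ) * (⌈(n : ℝ) ^ η⌉₊ : ℝ) ^ 2) ≤ (n : ℝ) ^ (2 - η / 2) := by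
  have hd : (d + 1 : ℝ) ≤ (s + 1) * (s + 1) := by exact_mod_cast hds
  calc _ ≤ 24 * ((s + 1 : ℝ) * (s + 1)) ^ 2 * 2 ^ s * (16 * (n : ℝ) ^ (2 - η)) := by
        gcongr
        exact bucket_count_le hn hη0 hη
    _ = 384 * (s + 1 : ℝ) ^ 4 * 2 ^ s * (n : ℝ) ^ (2 - η) := by ring
    _ ≤ (n : ℝ) ^ (η / 2) * (n : ℝ) ^ (2 - η) := by gcongr
    _ = (n : ℝ) ^ (2 - η / 2) := by
        rw [← Real.rpow_add (by exact_mod_cast hn)]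
        ring_nf

theorem ceil_rpow_mul_pow_le {c : ℝ} (hn : 1 ≤ n) (hη : 0 ≤ η) (hc : 8 * η ≤ c)
    (hd : Real.log n ≤ 4 * d) (hds : d ≤ s * s + 2 * s) (hs : 4 ≤ s) :
    (⌈(n : ℝ) ^ η⌉₊ : ℝ) * Real.exp (-c) ^ (s * s) ≤ 2 * Real.exp (-c) ^ s := by
  have hn0 : (0 : ℝ) < n := by exact_mod_cast hn
  have hs' : (4 : ℝ) ≤ s := by exact_mod_cast hs
  have hexponent : Real.log n * η ≤ (s * s - s) * c := by
    calc Real.log n * η ≤ 4 * (s * s + 2 * s) * η := by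
          gcongr
          exact hd.trans (by exact_mod_cast Nat.mul_le_mul_left 4 hds)
      _ = (s * s + 2 * s) / 2 * (8 * η) := by ring
      _ ≤ (s * s + 2 * s) / 2 * c := by gcongr
      _ ≤ (s * s - s) * c := by
          gcongr
          · linarith
          · nlinarith
  calc (⌈(n : ℝ) ^ η⌉₊ : ℝ) * Real.exp (-c) ^ (s * s)
      ≤ 2 * (n : ℝ) ^ η * Real.exp (-c) ^ (s * s) := by gcongr; exact ceil_rpow_le_two_mul hn hη
    _ = 2 * Real.exp (Real.log n * η + (s * s : ℕ) * (-c)) := by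
        rw [Real.rpow_def_of_pos hn0, ← Real.exp_nat_mul, Real.exp_add, mul_assoc]
    _ ≤ 2 * Real.exp (s * (-c)) := by
        gcongr
        push_cast
        linarith
    _ = _ := by rw [Real.exp_nat_mul]

theorem eventually_mul_pow_mul_two_pow_le {c : ℝ} (hc : 0 < c) :
    ∀ᶠ s : ℕ in atTop, 384 * (s + 1 : ℝ) ^ 4 * 2 ^ s ≤ Real.exp (c * s ^ 2) := by
  have h384 : (384 : ℝ) ≤ Real.exp 1 ^ 6 := by
    have := pow_le_pow_left₀ (by norm_num) Real.exp_one_gt_d9.le 6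
    exact le_trans (by norm_num) this
  have h2 : (2 : ℝ) ≤ Real.exp 1 := by linarith [Real.add_one_le_exp 1]
  filter_upwards [eventually_ge_atTop 1,
    tendsto_natCast_atTop_atTop.eventually_ge_atTop (11 / c)] with s hs hsc
  rw [div_le_iff₀ hc] at hsc
  calc 384 * (s + 1 : ℝ) ^ 4 * 2 ^ s ≤ Real.exp 1 ^ 6 * Real.exp s ^ 4 * Real.exp 1 ^ s := by
        gcongr
        exact Real.add_one_le_exp _
    _ = Real.exp (6 + 5 * s) := by
        rw [← Real.exp_nat_mul, ← Real.exp_nat_mul, ← Real.exp_nat_mul, ← Real.exp_add,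
          ← Real.exp_add]
        push_cast
        ring_nf
    _ ≤ Real.exp (c * s ^ 2) := by
        have : (1 : ℝ) ≤ s := by exact_mod_cast hs
        gcongr
        nlinarith

end BucketCount

section Regimes

variable {p : unitInterval}

theorem eventually_log_natCast {P : ℝ → Prop} (h : ∀ᶠ L in atTop, P L) :
    ∀ᶠ n : ℕ in atTop, P (Real.log n) :=
  (Real.tendsto_log_atTop.comp tendsto_natCast_atTop_atTop).eventually h

theorem eventually_forall_sqrt {P : ℕ → Prop} (h : ∀ᶠ s in atTop, P s) :
    ∀ᶠ n : ℕ in atTop, ∀ d : ℕ, Real.log n < 4 * d → P (Nat.sqrt d) := by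
  obtain ⟨s₀, hs₀⟩ := eventually_atTop.1 h
  filter_upwards [eventually_log_natCast (eventually_ge_atTop (4 * (s₀ * s₀ : ℝ)))] with n hn d hd
  refine hs₀ _ (Nat.le_sqrt.2 ?_)
  exact_mod_cast (by linarith : (s₀ * s₀ : ℝ) ≤ d)

theorem hasSoundFormula_of_sparse (hp1 : (p : ℝ) < 1) {n d : ℕ} (hn : 1 ≤ n)
    (h : 3 * Real.log n ≤ -Real.log (1 - (p : ℝ) ^ 2) * d) : HasSoundFormula p n d 1 (1 / n) := by
  have hq : 0 < 1 - (p : ℝ) ^ 2 := by nlinarith [p.2.1]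
  have : (0 : ℝ) < n := by exact_mod_cast hn
  refine hasSoundFormula_const.mono le_rfl (measureReal_hasOrthogonalPair_le.trans ?_)
  have hpow : (1 - (p : ℝ) ^ 2) ^ d ≤ (1 / n) ^ 3 := by
    rw [← Real.log_le_log_iff (by positivity) (by positivity), Real.log_pow, Real.log_pow,
      one_div, Real.log_inv]
    push_cast
    linarith
  calc (n : ℝ) ^ 2 * (1 - (p : ℝ) ^ 2) ^ d ≤ (n : ℝ) ^ 2 * (1 / n) ^ 3 := by gcongr
    _ = 1 / (n : ℝ) := by field_simp

theorem eventually_mul_add_le_exp {a b c : ℝ} (hc : 0 < c) :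
    ∀ᶠ L : ℝ in atTop, a * L + b ≤ Real.exp (c * L) := by
  have hlin : (fun L : ℝ => a * L + b) =o[atTop] fun L => Real.exp (c * L) := by
    simpa using ((isLittleO_pow_exp_pos_mul_atTop 1 hc).const_mul_left a).add
      (isLittleO_pow_exp_pos_mul_atTop 0 hc |>.const_mul_left b)
  filter_upwards [hlin.bound one_pos] with L hL
  simpa using (le_abs_self _).trans hL

theorem eventually_hasSoundFormula_of_dense {a b : ℝ} (hab : a < b) :
    ∀ᶠ n : ℕ in atTop, ∀ d : ℕ, (d : ℝ) ≤ a * Real.log n →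
      HasSoundFormula p n d ((n : ℝ) ^ (1 + b)) 0 := by
  filter_upwards [eventually_log_natCast (eventually_mul_add_le_exp (a := 4 * a) (b := 6)
    (sub_pos.2 hab)), eventually_ge_atTop 2] with n hexp hn d hd
  have hn0 : (0 : ℝ) < n := by positivity
  have hn1 : (1 : ℝ) ≤ n := by exact_mod_cast one_le_two.trans hn
  have htwo : (1 : ℝ) ≤ 2 ^ d := one_le_pow₀ one_le_two
  have htwo_pow : (2 : ℝ) ^ d ≤ Real.exp (a * Real.log n) := by
    calc (2 : ℝ) ^ d ≤ Real.exp 1 ^ d := by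
          gcongr
          linarith [Real.add_one_le_exp 1]
      _ = Real.exp d := by rw [← Real.exp_nat_mul, mul_one]
      _ ≤ _ := Real.exp_le_exp.2 hd
  refine (hasSoundFormula_exhaustive hn).mono ?_ le_rfl
  calc (2 : ℝ) ^ d * (2 * (n * (d * 2 + 1) + 1) + 1) + 1
      ≤ (2 : ℝ) ^ d * (n * (4 * d + 6)) := by
        nlinarith [mul_le_mul_of_nonneg_left hn1 (zero_le_one.trans htwo)]
    _ ≤ Real.exp (a * Real.log n) * (n * Real.exp ((b - a) * Real.log n)) := by
        gcongr
        linarith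
    _ = (n : ℝ) ^ (1 + b) := by
        rw [Real.rpow_add hn0, Real.rpow_one, Real.rpow_def_of_pos hn0, mul_left_comm,
          ← Real.exp_add]
        ring_nf

theorem eventually_hasSoundFormula_of_critical (hp0 : 0 < (p : ℝ)) (hp1 : (p : ℝ) < 1) {t η : ℝ}
    (ht : 0 < t) (hgap : orthParam p + 2 * t ≤ p)
    (hpow : (1 - p : ℝ) ^ (orthParam p - t : ℝ) ≤ √(1 - (p : ℝ) ^ 2))
    (hη0 : 0 < η) (hη : η ≤ 1 / 2) (hηt : 8 * η ≤ 2 * t ^ 2) {e : ℝ} (he : 0 < e) :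
    ∀ᶠ n : ℕ in atTop, ∀ d : ℕ, Real.log n < 4 * d →
      -Real.log (1 - (p : ℝ) ^ 2) * d ≤ 3 * Real.log n →
        HasSoundFormula p n d ((n : ℝ) ^ (2 - η / 2)) e := by
  set Λ := -Real.log (1 - (p : ℝ) ^ 2)
  have hΛ : 0 < Λ := neg_pos.2 (Real.log_neg (by nlinarith) (by nlinarith))
  have hρ : Real.exp (-2 * t ^ 2) < 1 := Real.exp_lt_one_iff.2 (by nlinarith)
  have herror := tendsto_search_error (Real.exp_pos _) hρ
  filter_upwards [eventually_ge_atTop 1, eventually_forall_sqrt ((eventually_ge_atTop 4).and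
    ((eventually_mul_pow_mul_two_pow_le (c := η * Λ / 6) (by positivity)).and
    (herror.eventually_le_const (lt_min he one_pos))))] with n hn hsqrt d hd hΛd
  obtain ⟨hs4, hsize, herr⟩ := hsqrt d hd
  have hn0 : (0 : ℝ) < n := by exact_mod_cast hn
  have hw : 1 ≤ ⌈(n : ℝ) ^ η⌉₊ := Nat.one_le_ceil_iff.2 (by positivity)
  have hs := Nat.sqrt_le d
  have hlog : η * Λ / 6 * (Nat.sqrt d : ℝ) ^ 2 ≤ Real.log n * (η / 2) := by
    have hsd : (Nat.sqrt d : ℝ) ^ 2 ≤ d := by exact_mod_cast Nat.sqrt_le' d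
    calc η * Λ / 6 * (Nat.sqrt d : ℝ) ^ 2 ≤ η * Λ / 6 * d := by gcongr
      _ = η / 6 * (Λ * d) := by ring
      _ ≤ η / 6 * (3 * Real.log n) := by gcongr
      _ = Real.log n * (η / 2) := by ring
  have hlight := ceil_rpow_mul_pow_le (s := Nat.sqrt d) hn hη0.le hηt hd.le
    (by linarith [Nat.sqrt_le_add d]) hs4
  rw [← neg_mul] at hlight
  refine (hasSoundFormula_search ht.le hgap hs (Nat.succ_pos _) hw (le_div_add_one_mul n hw) hp1
    hpow hlight ?_).mono (search_size_le hn hη0.le hη (Nat.lt_succ_sqrt d) ?_)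
      (herr.trans (min_le_left _ _))
  · have h96 : 0 ≤ 96 / (Nat.sqrt d + 2 : ℝ) := by positivity
    linarith [herr.trans (min_le_right _ _)]
  · rw [Real.rpow_def_of_pos hn0]
    exact hsize.trans (Real.exp_le_exp.2 hlog)

end Regimes

section Exponents

variable {p : unitInterval}

/-- The saving `ε` is achievable for `OV(p)`: sound formulas of size `n ^ (2 - ε)` have an error
that tends to `0` as `n → ∞`, uniformly in the dimension. -/
def AchievableSaving (p : unitInterval) (ε : ℝ) : Prop :=
  ∀ e > 0, ∀ᶠ n : ℕ in atTop, ∀ d : ℕ, HasSoundFormula p n d ((n : ℝ) ^ (2 - ε)) e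

theorem exists_achievableSaving (hp0 : 0 < (p : ℝ)) (hp1 : (p : ℝ) < 1) :
    ∃ ε > 0, ε ≤ 1 ∧ AchievableSaving p ε := by
  obtain ⟨t, ht, hgap, hpow⟩ := exists_gap hp0 hp1
  obtain ⟨η, hη0, hη⟩ := exists_between (show 0 < min (1 / 2) (t ^ 2 / 4) by positivity)
  obtain ⟨hη2, hηt⟩ := lt_min_iff.1 hη
  refine ⟨η / 2, by positivity, by linarith, fun e he => ?_⟩
  filter_upwards [eventually_hasSoundFormula_of_critical hp0 hp1 ht hgap hpow hη0 hη2.le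
      (by linarith) he,
    eventually_hasSoundFormula_of_dense (p := p) (a := 1 / 4) (b := 1 / 2) (by norm_num),
    eventually_ge_atTop 1, tendsto_one_div_atTop_nhds_zero_nat.eventually_le_const he]
    with n hcrit hdense hn hne d
  have hn1 : (1 : ℝ) ≤ n := by exact_mod_cast hn
  rcases lt_or_ge (Real.log n) (4 * d) with hd | hd
  · rcases le_or_gt (-Real.log (1 - (p : ℝ) ^ 2) * d) (3 * Real.log n) with hsparse | hsparse
    · exact hcrit d hd hsparse
    · exact (hasSoundFormula_of_sparse hp1 hn hsparse.le).mono
        (Real.one_le_rpow hn1 (by linarith)) hne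
  · exact (hdense d (by linarith)).mono (Real.rpow_le_rpow_of_exponent_le hn1 (by linarith)) he.le

theorem achievableSaving_one_sub_four_div (hp0 : 0 < (p : ℝ)) (hp1 : (p : ℝ) < 1) :
    AchievableSaving p (1 - 4 / -Real.log (1 - (p : ℝ) ^ 2)) := by
  intro e he
  have hΛ : 0 < -Real.log (1 - (p : ℝ) ^ 2) :=
    neg_pos.2 (Real.log_neg (by nlinarith) (by nlinarith))
  set Λ := -Real.log (1 - (p : ℝ) ^ 2)
  filter_upwards [eventually_hasSoundFormula_of_dense (p := p) (a := 3 / Λ) (b := 4 / Λ)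
    (by gcongr; norm_num), eventually_ge_atTop 1,
    tendsto_one_div_atTop_nhds_zero_nat.eventually_le_const he] with n hdense hn hne d
  have hn1 : (1 : ℝ) ≤ n := by exact_mod_cast hn
  rcases le_or_gt (3 * Real.log n) (Λ * d) with hsparse | hsparse
  · have : 0 < 4 / Λ := by positivity
    exact (hasSoundFormula_of_sparse hp1 hn hsparse).mono
      (Real.one_le_rpow hn1 (by linarith)) hne
  · rw [show 2 - (1 - 4 / Λ) = 1 + 4 / Λ by ring]
    refine (hdense d ?_).mono le_rfl he.le
    rw [div_mul_eq_mul_div, le_div_iff₀ hΛ]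
    linarith

theorem tendsto_one_sub_four_div_log :
    Tendsto (fun p : ℝ => 1 - 4 / -Real.log (1 - p ^ 2)) (𝓝[<] 1) (𝓝 1) := by
  have hq : Tendsto (fun p : ℝ => 1 - p ^ 2) (𝓝[<] 1) (𝓝[>] 0) := by
    refine tendsto_nhdsWithin_iff.2 ⟨?_, ?_⟩
    · have hcont : Continuous fun p : ℝ => 1 - p ^ 2 := by fun_prop
      simpa using (hcont.tendsto 1).mono_left nhdsWithin_le_nhds
    · filter_upwards [Ioo_mem_nhdsLT (show (0 : ℝ) < 1 by norm_num)] with p ⟨hp0, hp1⟩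
      exact sub_pos.2 (pow_lt_one₀ hp0.le hp1 two_ne_zero)
  have hlog : Tendsto (fun p : ℝ => -Real.log (1 - p ^ 2)) (𝓝[<] 1) atTop :=
    tendsto_neg_atBot_atTop.comp (Real.tendsto_log_nhdsGT_zero.comp hq)
  simpa using (tendsto_const_nhds (x := (4 : ℝ))).div_atTop hlog |>.const_sub 1

theorem exists_savings : ∃ ε : ℝ → ℝ, Tendsto ε (𝓝[<] 1) (𝓝 1) ∧
    ∀ (p : ℝ) (hp : p ∈ Set.Ioo (0 : ℝ) 1), 0 < ε p ∧ ε p ≤ 1 ∧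
      AchievableSaving ⟨p, Set.Ioo_subset_Icc_self hp⟩ (ε p) := by
  have hlarge (p : ℝ) (hp : p ∈ Set.Ioo (0 : ℝ) 1) : 1 - 4 / -Real.log (1 - p ^ 2) ≤ 1 := by
    have := Real.log_nonpos (by nlinarith [hp.1, hp.2]) (show 1 - p ^ 2 ≤ 1 by nlinarith)
    exact sub_le_self _ (div_nonneg (by norm_num) (by linarith))
  have hex (p : ℝ) : ∃ ε, ∀ hp : p ∈ Set.Ioo (0 : ℝ) 1, 1 - 4 / -Real.log (1 - p ^ 2) ≤ ε ∧
      0 < ε ∧ ε ≤ 1 ∧ AchievableSaving ⟨p, Set.Ioo_subset_Icc_self hp⟩ ε := by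
    by_cases hp : p ∈ Set.Ioo (0 : ℝ) 1
    · obtain ⟨ε, hε0, hε1, hε⟩ :=
        exists_achievableSaving (p := ⟨p, Set.Ioo_subset_Icc_self hp⟩) hp.1 hp.2
      refine ⟨max ε (1 - 4 / -Real.log (1 - p ^ 2)), fun _ => ⟨le_max_right _ _,
        lt_max_of_lt_left hε0, max_le hε1 (hlarge p hp), ?_⟩⟩
      rcases max_choice ε (1 - 4 / -Real.log (1 - p ^ 2)) with h | h <;> rw [h]
      exacts [hε, achievableSaving_one_sub_four_div (p := ⟨p, _⟩) hp.1 hp.2]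
    · exact ⟨0, fun h => absurd h hp⟩
  choose ε hε using hex
  refine ⟨ε, ?_, fun p hp => (hε p hp).2⟩
  have hIoo := Ioo_mem_nhdsLT (show (0 : ℝ) < 1 by norm_num)
  refine tendsto_of_tendsto_of_tendsto_of_le_of_le' tendsto_one_sub_four_div_log
    tendsto_const_nhds ?_ ?_ <;> filter_upwards [hIoo] with p hp
  exacts [(hε p hp).1, (hε p hp).2.2.1]

theorem exists_tendsto_of_eventually {Q : ℕ → ℝ → Prop} (hone : ∀ n, Q n 1)
    (h : ∀ e > 0, ∀ᶠ n in atTop, Q n e) :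
    ∃ δ : ℕ → ℝ, Tendsto δ atTop (𝓝 0) ∧ ∀ n, Q n (δ n) := by
  classical
  have hthreshold (k : ℕ) : ∃ N, ∀ n ≥ N, Q n (1 / ((k : ℝ) + 1)) :=
    eventually_atTop.1 (h _ (by positivity))
  choose N hN using hthreshold
  let κ : ℕ → ℕ := fun n => Nat.findGreatest (fun k => N k ≤ n) n
  refine ⟨fun n => 1 / ((κ n : ℝ) + 1), ?_, fun n => ?_⟩
  · refine tendsto_one_div_add_atTop_nhds_zero_nat.comp (tendsto_atTop.2 fun k => ?_)
    filter_upwards [eventually_ge_atTop k, eventually_ge_atTop (N k)] with n hkn hNn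
    exact Nat.le_findGreatest hkn hNn
  · by_cases hκ : κ n = 0
    · simpa [hκ] using hone n
    · exact hN _ n (Nat.findGreatest_of_ne_zero (P := fun k => N k ≤ n) rfl hκ)

end Exponents

theorem theorem4 :
    ∃ (ε : ℝ → ℝ) (D : ℕ),
      (∀ p ∈ Set.Ioo (0 : ℝ) 1, 0 < ε p) ∧
      Tendsto ε (𝓝[<] 1) (𝓝 1) ∧
      ∀ (p : ℝ) (hp : p ∈ Set.Ioo (0 : ℝ) 1),
        ∃ δ : ℕ → ℝ, Tendsto δ atTop (𝓝 0) ∧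
          ∀ n d : ℕ, 1 ≤ n →
            ∃ F : BoolFormula (Fin n × Fin d),
              F.depth ≤ D ∧
              (F.size : ℝ) ≤ (n : ℝ) ^ (2 - ε p) ∧
              (∀ x : OVInstance n d, F.output x = true → x.HasOrthogonalPair) ∧
              (ovMeasure ⟨p, Set.Ioo_subset_Icc_self hp⟩ n d).real
                {x | ¬ (F.output x = true ↔ x.HasOrthogonalPair)} ≤ δ n := by
  obtain ⟨ε, hlim, hε⟩ := exists_savings
  refine ⟨ε, 12, fun p hp => (hε p hp).1, hlim, fun p hp => ?_⟩
  obtain ⟨-, hε1, hsaving⟩ := hε p hp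
  obtain ⟨δ, hδ, hF⟩ := exists_tendsto_of_eventually
    (Q := fun n e => 1 ≤ n → ∀ d,
      HasSoundFormula ⟨p, Set.Ioo_subset_Icc_self hp⟩ n d ((n : ℝ) ^ (2 - ε p)) e)
    (fun n hn d => hasSoundFormula_const.mono
      (Real.one_le_rpow (by exact_mod_cast hn) (by linarith)) measureReal_le_one)
    fun e he => (hsaving e he).mono fun _ hF _ => hF
  exact ⟨δ, hδ, fun n d hn => hF n hn d⟩
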